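/- Let $\mathsf Z$ be a nonempty Borel subset of $\mathbb R^m$ and let $P$ be a Feller stochastic kernel on $\mathsf Z$. Let $(z_t)_{t\ge 0}$ be a Markov process with kernel $P$, and let $(\zeta_t)_{t\ge1}$ be iid with law $\nu$ and $(\eta_t)_{t\ge1}$ iid with law $\mu$, the three processes being independent. Put $R_t=R(z_t,\zeta_t)$ and $Y_t=Y(z_t,\eta_t)$, where $R,Y\ge 0$ are measurable real-valued functions. Write $\mathbb E_z$ for expectation given $z_0=z$, and $\hat z,\hat R,\hat Y$ for the next-period values, so that $\mathbb E_z f(\hat z,\hat R,\hat Y)=\int f(\hat z,R(\hat z,\zeta),Y(\hat z,\eta))\,P(z,d\hat z)\,\nu(d\zeta)\,\mu(d\eta)$. Let $\beta\in[0,1)$ and $u:[0,\infty)\to\{-\infty\}\cup\mathbb R$. We use the conventions $u'(0)=\infty$ and $0\cdot\infty=0$. Let $\mathsf S_0=(0,\infty)\times\mathsf Z$ and $\mathsf S=[0,\infty)\times \mathsf Z$. A feasible policy is a measurable $c:\mathsf S_0\to\mathbb R$ with $0\le c(a,z)\le a$; it is extended to $\mathsf S$ by $c(0,z)=0$. It generates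 wealth $a_{t+1}=R_{t+1}(a_t-c(a_t,z_t))+Y_{t+1}$ from $(a_0,z_0)=(a,z)$ and has lifetime value $V_c(a,z)=\mathbb E_{a,z}\sum_{t\ge0}\beta^t u(c(a_t,z_t))$. It is optimal if $V_d\le V_c$ on $\mathsf S_0$ for every feasible $d$. Let $\mathscr C$ be the set of continuous $c:\mathsf S_0\to\mathbb R$ that are increasing in $a$ and satisfy $0<c(a,z)\le a$ and $\sup_{\mathsf S_0}|u'(c(a,z))-u'(a)|<\infty$. Assume: 1. $u$ is twice differentiable on $(0,\infty)$ with $u'>0$, $u''<0$, $u'(x)\to\infty$ as $x\to0$, $u'(x)\to0$ as $x\to\infty$, and $u(0)\le u(x)$ for all $x>0$. 2. $\beta^n\sup_z\mathbb E_zR_1\cdots R_n<1$ for some $n\ge1$. 3. $\sum_{t\ge1}\beta^t\mathbb E_zY_t<\infty$ for all $z$. 4. $\sup_z\mathbb E_z\hat R$, $\sup_z\mathbb E_zu'(\hat Y)$ and $\sup_z\mathbb E_z\hat Ru'(\hat Y)$ are finite. 5. $z\mapsto R(z,\zeta)$ for each $\zeta$, $z\mapsto Y(z,\eta)$ for each $\eta$,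 $z\mapsto\mathbb E_z\hat R$ and $z\mapsto\mathbb E_z\hat Ru'(\hat Y)$ are continuous. 6. There is $\alpha\in(0,1)$ such that $\beta\,\mathbb E_z\hat R\,u'[\hat R(1-\alpha)a]\le u'(a)$ for all $(a,z)\in\mathsf S_0$, and $(1-\alpha)^n\sup_z\mathbb E_zR_1\cdots R_n<1$ for some $n\ge1$. 7. $\sup_{t\ge1}\mathbb E_zY_t<\infty$ for all $z$. 8. $P$ is bounded in probability, i.e. $\{P^t(z,\cdot)\}_{t\ge0}$ is tight for every $z\in\mathsf Z$. Then there is exactly one optimal policy $c^*$ in $\mathscr C$, and the stochastic kernel $Q$ on $\mathsf S$ of the state process $(a_t,z_t)$ under $c^*$ is bounded in probability (that is, $\{Q^t(s,\cdot)\}_{t\ge0}$ is tight for every $s\in\mathsf S$) and admits at least one stationary distribution (a probability measure $\psi$ on $\mathsf S$ with $\psi Q=\psi$). -/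

import Mathlib

open MeasureTheory ProbabilityTheory Filter Topology
open scoped NNReal ENNReal BoundedContinuousFunction

noncomputable section

namespace IncomeFluctuation

/-- A stochastic kernel is Feller if it maps bounded continuous functions to bounded continuous
functions (boundedness of the image is automatic for a Markov kernel). -/
def IsFeller {X : Type*} [TopologicalSpace X] [MeasurableSpace X] (P : Kernel X X) : Prop :=
  ∀ h : X →ᵇ ℝ, Continuous fun x => ∫ y, h y ∂(P x)

/-- A stochastic kernel `Q` is bounded in probability if, for every `x`, the sequence
`Q ^ t (x, ·)`, `t ≥ 0`, of `t`-step transition probabilities is tight. -/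
def BoundedInProbability {X : Type*} [TopologicalSpace X] [MeasurableSpace X]
    (Q : Kernel X X) : Prop :=
  ∀ x, IsTightMeasureSet (Set.range fun t : ℕ => (Q ^ t) x)

/-- `ψ` is a stationary distribution of `Q`: a probability measure with `ψ Q = ψ`. -/
def IsStationary {X : Type*} [MeasurableSpace X] (Q : Kernel X X) (ψ : Measure X) : Prop :=
  IsProbabilityMeasure ψ ∧ Q.Invariant ψ

/-- The primitives of the income fluctuation problem. `Z` is the space of the exogenous Markov
state, `E` and `H` are the spaces of the return innovations `ζ` and the income innovations `η`. -/
structure Model (Z E H : Type*) [TopologicalSpace Z] [MeasurableSpace Z] [MeasurableSpace E]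
    [MeasurableSpace H] where
  /-- discount factor, in `[0, 1)` -/
  β : ℝ≥0
  β_lt_one : β < 1
  /-- utility, with values in `{-∞} ∪ ℝ` by the assumption `Utility` below -/
  u : ℝ≥0 → EReal
  /-- transition kernel of the exogenous state -/
  P : Kernel Z Z
  markov_P : IsMarkovKernel P
  feller_P : IsFeller P
  /-- law of the return innovations -/
  ν : Measure E
  prob_ν : IsProbabilityMeasure ν
  /-- law of the income innovations -/
  μ : Measure H
  prob_μ : IsProbabilityMeasure μ
  /-- gross return on wealth, as a function of `(z, ζ)` -/
  R : Z × E → ℝ≥0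
  measurable_R : Measurable R
  /-- labor income, as a function of `(z, η)` -/
  Y : Z × H → ℝ≥0
  measurable_Y : Measurable Y

namespace Model

variable {Z E H : Type*} [TopologicalSpace Z] [MeasurableSpace Z] [MeasurableSpace E]
  [MeasurableSpace H] (M : Model Z E H)

instance : IsMarkovKernel M.P := M.markov_P
instance : IsProbabilityMeasure M.ν := M.prob_ν
instance : IsProbabilityMeasure M.μ := M.prob_μ

/-- Return at the shock `w = (z, ζ, η)`. -/
def ret (w : Z × E × H) : ℝ≥0 := M.R (w.1, w.2.1)

/-- Income at the shock `w = (z, ζ, η)`. -/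
def inc (w : Z × E × H) : ℝ≥0 := M.Y (w.1, w.2.2)

lemma measurable_ret : Measurable M.ret :=
  M.measurable_R.comp (by fun_prop)

lemma measurable_inc : Measurable M.inc :=
  M.measurable_Y.comp (by fun_prop)

/-- The law `P(z, dẑ) ν(dζ̂) μ(dη̂)` of the next period's `(ẑ, ζ̂, η̂)` given the current `z`. -/
def shock : Kernel Z (Z × E × H) := M.P ×ₖ Kernel.const Z (M.ν.prod M.μ)

instance : IsMarkovKernel M.shock := by unfold shock; infer_instance

/-- The law of the exogenous process `(z_t, ζ_t, η_t)`, `t ≥ 0`, given `z_0 = z`: `z_t` is a Markov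
process with kernel `P`, the innovations are iid with laws `ν` and `μ`, and everything is
independent. The time-zero innovations are never used. -/
def pathLaw (z : Z) : Measure (ℕ → Z × E × H) :=
  Kernel.trajMeasure (X := fun _ => Z × E × H) ((Measure.dirac z).prod (M.ν.prod M.μ))
    (fun n => M.shock.comap (fun h => (h ⟨n, Finset.mem_Iic.2 le_rfl⟩).1) (by fun_prop))

/-- `𝔼_z f(ẑ, ζ̂, η̂)` for a function of the next period's shocks. -/
def E1 (z : Z) (f : Z × E × H → ℝ≥0∞) : ℝ≥0∞ := ∫⁻ w, f w ∂(M.shock z)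

/-- `𝔼_z f` for a function of the whole exogenous path. -/
def Epath (z : Z) (f : (ℕ → Z × E × H) → ℝ≥0∞) : ℝ≥0∞ := ∫⁻ ω, f ω ∂(M.pathLaw z)

/-- `𝔼_z R_1 ⋯ R_n`. -/
def expRetProd (n : ℕ) (z : Z) : ℝ≥0∞ :=
  M.Epath z fun ω => ∏ i ∈ Finset.Icc 1 n, (M.ret (ω i) : ℝ≥0∞)

/-- `𝔼_z Y_t`, meant for `t ≥ 1`. -/
def expInc (t : ℕ) (z : Z) : ℝ≥0∞ := M.Epath z fun ω => (M.inc (ω t) : ℝ≥0∞)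

/-- The real-valued version of `u`, used on `(0, ∞)` only. -/
def uReal (x : ℝ) : ℝ := (M.u x.toNNReal).toReal

/-- Marginal utility `u'`, with `u'(0) = ∞`. -/
def u' (x : ℝ≥0) : ℝ≥0∞ := if x = 0 then ⊤ else ENNReal.ofReal (deriv M.uReal x)

/-! ### Assumptions on the primitives -/

/-- `u : ℝ₊ → {-∞} ∪ ℝ` is increasing at zero and twice differentiable on `(0, ∞)`, with `u' > 0`,
`u'' < 0`, `u'(0+) = ∞` and `u'(∞) = 0`. -/
structure Utility : Prop where
  ne_top : ∀ x, M.u x ≠ ⊤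
  ne_bot : ∀ x, 0 < x → M.u x ≠ ⊥
  zero_le : ∀ x, M.u 0 ≤ M.u x
  differentiable : ∀ x : ℝ, 0 < x → DifferentiableAt ℝ M.uReal x
  differentiable_deriv : ∀ x : ℝ, 0 < x → DifferentiableAt ℝ (deriv M.uReal) x
  deriv_pos : ∀ x : ℝ, 0 < x → 0 < deriv M.uReal x
  deriv2_neg : ∀ x : ℝ, 0 < x → deriv (deriv M.uReal) x < 0
  tendsto_zero : Tendsto (deriv M.uReal) (𝓝[>] 0) atTop
  tendsto_top : Tendsto (deriv M.uReal) atTop (𝓝 0)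

/-- For some `n ≥ 1`, `β ^ n sup_z 𝔼_z R_1 ⋯ R_n < 1`. -/
def ReturnGrowth : Prop :=
  ∃ n : ℕ, 1 ≤ n ∧ (M.β : ℝ≥0∞) ^ n * (⨆ z, M.expRetProd n z) < 1

/-- For all `z`, `∑_{t ≥ 1} β ^ t 𝔼_z Y_t < ∞`. -/
def DiscountedIncome : Prop :=
  ∀ z, (∑' t : ℕ, (M.β : ℝ≥0∞) ^ (t + 1) * M.expInc (t + 1) z) < ⊤

/-- `𝔼_z R̂`, `𝔼_z u'(Ŷ)` and `𝔼_z R̂ u'(Ŷ)` are bounded in `z`. -/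
structure BoundedMoments : Prop where
  ret : (⨆ z, M.E1 z (fun w => M.ret w)) < ⊤
  marg : (⨆ z, M.E1 z (fun w => M.u' (M.inc w))) < ⊤
  ret_marg : (⨆ z, M.E1 z (fun w => M.ret w * M.u' (M.inc w))) < ⊤

/-- Continuity in `z` of `R(z, ζ)`, `Y(z, η)`, `𝔼_z R̂` and `𝔼_z R̂ u'(Ŷ)`. -/
structure ContinuousPrimitives : Prop where
  R : ∀ ζ, Continuous fun z => M.R (z, ζ)
  Y : ∀ η, Continuous fun z => M.Y (z, η)
  ret : Continuous fun z => M.E1 z (fun w => M.ret w)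
  ret_marg : Continuous fun z => M.E1 z (fun w => M.ret w * M.u' (M.inc w))

/-- The patience condition: for some `α ∈ (0, 1)`, `β 𝔼_z R̂ u'(R̂ (1 - α) a) ≤ u'(a)` for all
`a > 0` and `z` (with `0 · ∞ = 0`), and `(1 - α) ^ n sup_z 𝔼_z R_1 ⋯ R_n < 1` for some `n ≥ 1`. -/
def Patience : Prop :=
  ∃ α : ℝ≥0, 0 < α ∧ α < 1 ∧
    (∀ (a : ℝ≥0) (z : Z), 0 < a →
      M.β * M.E1 z (fun w => M.ret w * M.u' (M.ret w * (1 - α) * a)) ≤ M.u' a) ∧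
    ∃ n : ℕ, 1 ≤ n ∧ ((1 - α : ℝ≥0) : ℝ≥0∞) ^ n * (⨆ z, M.expRetProd n z) < 1

/-- For all `z`, `sup_{t ≥ 1} 𝔼_z Y_t < ∞`. -/
def BoundedIncome : Prop := ∀ z, (⨆ t : ℕ, M.expInc (t + 1) z) < ⊤

end Model

/-- A feasible policy: a measurable `c` on `(0, ∞) × Z` with `0 ≤ c(a, z) ≤ a`, extended to
`[0, ∞) × Z` by `c(0, z) = 0` (the constraint `c(a, z) ≤ a` forces this value). -/
@[ext]
structure Policy (Z : Type*) [MeasurableSpace Z] where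
  /-- consumption at `(a, z)` -/
  toFun : ℝ≥0 × Z → ℝ≥0
  measurable' : Measurable toFun
  le' : ∀ s, toFun s ≤ s.1

namespace Model

variable {Z E H : Type*} [TopologicalSpace Z] [MeasurableSpace Z] [MeasurableSpace E]
  [MeasurableSpace H] (M : Model Z E H)

/-- Next period's state `(â, ẑ)`, `â = R̂ (a - c(a, z)) + Ŷ`, given the state `s = (a, z)` and the
shock `w = (ẑ, ζ̂, η̂)`. -/
def step (c : Policy Z) (s : ℝ≥0 × Z) (w : Z × E × H) : ℝ≥0 × Z :=
  (M.ret w * (s.1 - c.toFun s) + M.inc w, w.1)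

lemma measurable_step (c : Policy Z) :
    Measurable fun p : (ℝ≥0 × Z) × (Z × E × H) => M.step c p.1 p.2 := by
  have h1 : Measurable fun p : (ℝ≥0 × Z) × (Z × E × H) => M.ret p.2 :=
    M.measurable_ret.comp measurable_snd
  have h2 : Measurable fun p : (ℝ≥0 × Z) × (Z × E × H) => M.inc p.2 :=
    M.measurable_inc.comp measurable_snd
  have h3 : Measurable fun p : (ℝ≥0 × Z) × (Z × E × H) => c.toFun p.1 :=
    c.measurable'.comp measurable_fst
  have h4 : Measurable fun p : (ℝ≥0 × Z) × (Z × E × H) => p.1.1 := by fun_prop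
  have h5 : Measurable fun p : (ℝ≥0 × Z) × (Z × E × H) => p.2.1 := by fun_prop
  exact ((h1.mul (h4.sub h3)).add h2).prodMk h5

/-- The state `(a_t, z_t)` along the exogenous path `ω` under the policy `c`, with `a_0 = a`. -/
def state (c : Policy Z) (a : ℝ≥0) (ω : ℕ → Z × E × H) : ℕ → ℝ≥0 × Z
  | 0 => (a, (ω 0).1)
  | t + 1 => M.step c (state c a ω t) (ω (t + 1))

/-- The lifetime value `V_c(a, z) = 𝔼_{a,z} ∑_{t ≥ 0} β ^ t u(c(a_t, z_t))`, as the expectation of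
the positive part minus the expectation of the negative part. -/
def value (c : Policy Z) (s : ℝ≥0 × Z) : EReal :=
  ((M.Epath s.2 fun ω => ∑' t : ℕ,
      (M.β : ℝ≥0∞) ^ t * (M.u (c.toFun (M.state c s.1 ω t))).toENNReal : ℝ≥0∞) : EReal) -
  ((M.Epath s.2 fun ω => ∑' t : ℕ,
      (M.β : ℝ≥0∞) ^ t * (-M.u (c.toFun (M.state c s.1 ω t))).toENNReal : ℝ≥0∞) : EReal)

/-- `c` is optimal: it maximizes lifetime value at every `(a, z) ∈ (0, ∞) × Z` among all feasible
policies. -/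
def IsOptimal (c : Policy Z) : Prop :=
  ∀ d : Policy Z, ∀ s : ℝ≥0 × Z, 0 < s.1 → M.value d s ≤ M.value c s

/-- The class of candidate policies: on `(0, ∞) × Z`, `c` is continuous, increasing in wealth,
strictly positive, and `u' ∘ c` is at bounded distance from `u'(a)`. -/
structure Candidate (c : Policy Z) : Prop where
  continuousOn : ContinuousOn c.toFun {s | 0 < s.1}
  mono : ∀ (a b : ℝ≥0) (z : Z), 0 < a → a ≤ b → c.toFun (a, z) ≤ c.toFun (b, z)
  pos : ∀ s, 0 < s.1 → 0 < c.toFun s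
  bounded : ∃ K : ℝ, ∀ s : ℝ≥0 × Z, 0 < s.1 →
    |deriv M.uReal (c.toFun s) - deriv M.uReal s.1| ≤ K

/-- The stochastic kernel `Q` of the state process `(a_t, z_t)` under the policy `c`: `Q(s, ·)` is
the law of the next state given the current state `s`. -/
def stateKernel (c : Policy Z) : Kernel (ℝ≥0 × Z) (ℝ≥0 × Z) :=
  (Kernel.id ×ₖ M.shock.comap Prod.snd measurable_snd).map fun p => M.step c p.1 p.2

lemma stateKernel_apply (c : Policy Z) (s : ℝ≥0 × Z) :
    M.stateKernel c s = (M.shock s.2).map (M.step c s) := by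
  have h := M.measurable_step c
  rw [stateKernel, Kernel.map_apply _ h, Kernel.prod_apply, Kernel.id_apply, Kernel.comap_apply,
    Measure.dirac_prod, Measure.map_map h (by fun_prop)]
  rfl

instance (c : Policy Z) : IsMarkovKernel (M.stateKernel c) :=
  Kernel.IsMarkovKernel.map _ (M.measurable_step c)

end Model

end IncomeFluctuation

end

noncomputable section

namespace IncomeFluctuation

/-! ### Lower semicontinuity of integrals -/

/-! The argument works with the marginal value p = u' ∘ c and the Euler equation: β 𝔼_z R̂ p(R̂(a -
c) + Ŷ, ẑ) ≤ p(a, z), with equality wherever c < a.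

Existence. Time iteration (`timeIter`) starts at p = u', i.e. at consuming all wealth, and produces
an increasing sequence. Assumption 2 gives a bounded weight κ ≥ 1 and l < 1 with β 𝔼_z R̂ κ(ẑ) ≤ l
κ(z) (`exists_weight`). With it the iterates stay below u' + Cκ and their increments are at most C
lⁿ κ, so the limit is a continuous fixed point at bounded distance from u'
(`isMargFixed_iSup_margIter`). Inverting u' gives a candidate policy that solves the Euler equation
(`IsMargFixed.isEuler`). Continuity of integrals of unbounded functions comes from semicontinuity:
two lower semicontinuous functions with a continuous finite sum are both continuous.

Optimality and uniqueness. Let d be any feasible policy. The tangent inequality for u at c_t bounds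
the gain of d over c in each period by u'(c_t)(d_t - c_t). By the Euler equation the discounted
expectations of these bounds telescope, up to a term β^T 𝔼 u'(c_T) a_T that vanishes
(`IsEuler.tsum_util_le`). Strict concavity at time zero makes d strictly worse at every state with
positive wealth where it differs from c (`IsEuler.value_lt`), so c is the only optimal policy, even
outside the candidate class.

Stability. The patience condition keeps every iterate below u'(αa), so c ≥ αa and at most (1 - α)a
is saved. A second weight, built with 1 - α in place of β, bounds 𝔼 a_t uniformly in t. Markov's
inequality and tightness of z_t then give tightness of the state
(`boundedInProbability_stateKernel`). The state kernel is Feller, and Krylov–Bogoliubov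
(`exists_isStationary`) yields a stationary distribution. -/

lemma lowerSemicontinuous_lintegral_param {X T : Type*} [TopologicalSpace X]
    [FirstCountableTopology X] [MeasurableSpace T] {ν : Measure T} {F : X → T → ℝ≥0∞}
    (hm : ∀ x, Measurable (F x)) (h : ∀ t, LowerSemicontinuous fun x => F x t) :
    LowerSemicontinuous fun x => ∫⁻ t, F x t ∂ν := by
  intro x y hy
  by_contra hcon
  rw [not_eventually] at hcon
  -- If the claim fails, first countability gives a sequence tending to `x` along which the
  -- integrals stay at most `y`; Fatou's lemma contradicts this.
  obtain ⟨s, hs, hsy⟩ := exists_seq_forall_of_frequently (l := 𝓝 x) hcon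
  have h1 : ∫⁻ t, F x t ∂ν ≤ ∫⁻ t, liminf (fun n => F (s n) t) atTop ∂ν := by
    refine lintegral_mono fun t => ?_
    refine le_of_forall_lt fun b hb => ?_
    obtain ⟨b', hb', hb''⟩ := exists_between hb
    refine hb'.trans_le ?_
    refine le_liminf_of_le (by isBoundedDefault) ?_
    exact (hs.eventually (h t x b' hb'')).mono fun n hn => hn.le
  have h2 : ∫⁻ t, liminf (fun n => F (s n) t) atTop ∂ν ≤
      liminf (fun n => ∫⁻ t, F (s n) t ∂ν) atTop := lintegral_liminf_le fun n => hm (s n)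
  have h3 : liminf (fun n => ∫⁻ t, F (s n) t ∂ν) atTop ≤ y := by
    refine liminf_le_of_le (by isBoundedDefault) fun b hb => ?_
    obtain ⟨n, hn⟩ := hb.exists
    exact hn.trans (not_lt.1 (hsy n))
  exact absurd (h1.trans (h2.trans h3)) (not_le.2 hy)

/-- By the layer-cake formula the integral is an integral over levels t of the measures of the open
sets {t < f}, and these are lower semicontinuous by the portmanteau theorem. -/
lemma lowerSemicontinuous_lintegral_real {X Ω : Type*} [TopologicalSpace X]
    [FirstCountableTopology X] [TopologicalSpace Ω] [MeasurableSpace Ω] [BorelSpace Ω]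
    [HasOuterApproxClosed Ω] {μ : X → ProbabilityMeasure Ω} (hμ : Continuous μ) {f : Ω → ℝ}
    (hf0 : ∀ x, 0 ≤ f x) (hf : LowerSemicontinuous f) :
    LowerSemicontinuous fun x => ∫⁻ y, ENNReal.ofReal (f y) ∂(μ x : Measure Ω) := by
  have h1 : ∀ x, ∫⁻ y, ENNReal.ofReal (f y) ∂(μ x : Measure Ω) =
      ∫⁻ t in Set.Ioi 0, (μ x : Measure Ω) {a | t < f a} := fun x =>
    lintegral_eq_lintegral_meas_lt _ (Eventually.of_forall hf0) hf.measurable.aemeasurable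
  simp_rw [h1]
  refine lowerSemicontinuous_lintegral_param (fun x => ?_) (fun t => ?_)
  · refine Antitone.measurable fun s t hst => measure_mono fun a ha => ?_
    exact lt_of_le_of_lt hst ha
  · rw [lowerSemicontinuous_iff_le_liminf]
    intro x
    exact ProbabilityMeasure.le_liminf_measure_open_of_tendsto (hμ.tendsto x)
      (hf.isOpen_preimage t)

/-- The truncations min(f, n) are finite and reduce to the real case; a supremum of lower
semicontinuous functions is lower semicontinuous. -/
lemma lowerSemicontinuous_lintegral_measure {X Ω : Type*} [TopologicalSpace X]
    [FirstCountableTopology X] [TopologicalSpace Ω] [MeasurableSpace Ω] [BorelSpace Ω]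
    [HasOuterApproxClosed Ω] {μ : X → ProbabilityMeasure Ω} (hμ : Continuous μ) {f : Ω → ℝ≥0∞}
    (hf : LowerSemicontinuous f) :
    LowerSemicontinuous fun x => ∫⁻ y, f y ∂(μ x : Measure Ω) := by
  have hne : ∀ (n : ℕ) (y : Ω), min (f y) n ≠ ⊤ := fun n y =>
    ((min_le_right _ _).trans_lt (ENNReal.natCast_lt_top n)).ne
  have hsup : ∀ y, f y = ⨆ n : ℕ, min (f y) n := by
    intro y
    have h : (⨆ n : ℕ, min (f y) n) = min (f y) (⨆ n : ℕ, (n : ℝ≥0∞)) := (inf_iSup_eq _ _).symm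
    rw [h, ENNReal.iSup_natCast, min_eq_left le_top]
  have h1 : ∀ x, ∫⁻ y, f y ∂(μ x : Measure Ω) =
      ⨆ n : ℕ, ∫⁻ y, ENNReal.ofReal (min (f y) n).toReal ∂(μ x : Measure Ω) := by
    intro x
    simp_rw [ENNReal.ofReal_toReal (hne _ _)]
    rw [← lintegral_iSup]
    · exact lintegral_congr hsup
    · exact fun n => hf.measurable.min measurable_const
    · intro m n hmn y
      exact min_le_min le_rfl (by exact_mod_cast hmn)
  simp_rw [h1]
  refine lowerSemicontinuous_iSup fun n => lowerSemicontinuous_lintegral_real hμ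
    (fun _ => ENNReal.toReal_nonneg) ?_
  intro y b hb
  change b < (min (f y) n).toReal at hb
  change ∀ᶠ y' in 𝓝 y, b < (min (f y') n).toReal
  rcases lt_or_ge b 0 with hb0 | hb0
  · exact Eventually.of_forall fun _ => hb0.trans_le ENNReal.toReal_nonneg
  rw [← ENNReal.ofReal_lt_iff_lt_toReal hb0 (hne n y), lt_min_iff] at hb
  filter_upwards [hf y _ hb.1] with y' hy'
  rw [← ENNReal.ofReal_lt_iff_lt_toReal hb0 (hne n y'), lt_min_iff]
  exact ⟨hy', hb.2⟩

/-- The parameter is absorbed into the measure: x ↦ δ_x ⊗ μ_x is weakly continuous. -/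
lemma lowerSemicontinuous_lintegral_joint {X Ω : Type*} [TopologicalSpace X]
    [TopologicalSpace.PseudoMetrizableSpace X] [SecondCountableTopology X] [MeasurableSpace X]
    [BorelSpace X] [TopologicalSpace Ω]
    [TopologicalSpace.PseudoMetrizableSpace Ω] [SecondCountableTopology Ω] [MeasurableSpace Ω]
    [BorelSpace Ω] {μ : X → ProbabilityMeasure Ω} (hμ : Continuous μ) {f : X × Ω → ℝ≥0∞}
    (hf : LowerSemicontinuous f) :
    LowerSemicontinuous fun x => ∫⁻ y, f (x, y) ∂(μ x : Measure Ω) := by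
  have hc : Continuous fun x => (diracProba x).prod (μ x) :=
    ProbabilityMeasure.continuous_prod.comp (continuous_diracProba.prodMk hμ)
  have h := lowerSemicontinuous_lintegral_measure hc hf
  convert h using 2 with x
  have : ((diracProba x).prod (μ x) : Measure (X × Ω)) =
      (Measure.dirac x).prod (μ x : Measure Ω) := rfl
  rw [this, Measure.dirac_prod, lintegral_map hf.measurable (by fun_prop)]

lemma lowerSemicontinuous_nnreal_mul {X : Type*} [TopologicalSpace X] {r : X → ℝ≥0}
    {g : X → ℝ≥0∞} (hr : Continuous r) (hg : LowerSemicontinuous g) :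
    LowerSemicontinuous fun x => (r x : ℝ≥0∞) * g x := by
  intro x y hy
  have hr0 : (r x : ℝ≥0∞) ≠ 0 := fun h => by simp [h] at hy
  have h1 : y / r x < g x := by
    rw [ENNReal.div_lt_iff (Or.inl hr0) (Or.inl ENNReal.coe_ne_top), mul_comm]
    exact hy
  obtain ⟨b, hb, hb'⟩ := exists_between h1
  have hc : Tendsto (fun x' => y / (r x' : ℝ≥0∞)) (𝓝 x) (𝓝 (y / r x)) := by
    refine ENNReal.Tendsto.const_div ?_ (Or.inl ENNReal.coe_ne_top)
    exact (ENNReal.continuous_coe.comp hr).tendsto x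
  have hr' : ∀ᶠ x' in 𝓝 x, (r x' : ℝ≥0∞) ≠ 0 :=
    ((ENNReal.continuous_coe.comp hr).tendsto x).eventually_ne hr0
  filter_upwards [hc.eventually_lt_const hb, hg x b hb', hr'] with x' h1' h2' h3'
  have := h1'.trans h2'
  rwa [ENNReal.div_lt_iff (Or.inl h3') (Or.inl ENNReal.coe_ne_top), mul_comm] at this

/-- Truncated subtraction fails to be continuous only at `⊤ - ⊤`, where it takes its least value 0,
so lower semicontinuity survives. -/
lemma lowerSemicontinuous_ennreal_sub {X : Type*} [TopologicalSpace X] {f g : X → ℝ≥0∞}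
    (hf : Continuous f) (hg : Continuous g) : LowerSemicontinuous fun x => f x - g x := by
  intro x y hy
  have h : g x ≠ ⊤ := fun h => by simp [h] at hy
  exact (ENNReal.Tendsto.sub (hf.tendsto x) (hg.tendsto x) (Or.inr h)).eventually_const_lt hy

/-- Formally f = (f + g) - g is continuous minus lower semicontinuous, hence also upper
semicontinuous. This replaces dominated convergence when the measure varies. -/
lemma continuous_of_lowerSemicontinuous_add {X : Type*} [TopologicalSpace X] {f g : X → ℝ≥0∞}
    (hf : LowerSemicontinuous f) (hg : LowerSemicontinuous g)
    (hfg : Continuous fun x => f x + g x) (hfin : ∀ x, f x + g x ≠ ⊤) : Continuous f := by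
  rw [continuous_iff_lower_upperSemicontinuous]
  refine ⟨hf, fun x y hy => ?_⟩
  have hgx : g x ≠ ⊤ := fun h => hfin x (by simp [h])
  rcases eq_or_ne y ⊤ with rfl | hy'
  · exact Eventually.of_forall fun x' =>
      lt_of_le_of_lt le_self_add (lt_top_iff_ne_top.2 (hfin x'))
  obtain ⟨m, hm, hm'⟩ := exists_between hy
  have hmt : m ≠ ⊤ := hm'.ne_top
  rcases eq_or_ne (g x) 0 with hg0 | hg0
  · have : f x + g x < m := by rw [hg0, add_zero]; exact hm
    filter_upwards [(hfg.tendsto x).eventually_lt_const this] with x' hx'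
    exact lt_of_le_of_lt le_self_add (hx'.trans hm')
  have hsum : f x + g x < m + g x := by
    exact (ENNReal.add_lt_add_iff_right hgx).2 hm
  -- Near x, f + g stays below m + g x and g stays above b, so f ≥ y would contradict m + g x < y +
  -- b. The case g x = 0 is separate because no b lies below it.
  obtain ⟨b, hb, hlt⟩ : ∃ b, b < g x ∧ m + g x < y + b := by
    have h1 : m + g x < y + g x := (ENNReal.add_lt_add_iff_right hgx).2 hm'
    have hc : Tendsto (fun b => y + b) (𝓝[<] (g x)) (𝓝 (y + g x)) :=
      ((continuous_const.add continuous_id).tendsto (g x)).mono_left nhdsWithin_le_nhds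
    have : (𝓝[<] (g x)).NeBot := nhdsLT_neBot_of_exists_lt ⟨0, pos_iff_ne_zero.2 hg0⟩
    obtain ⟨b, hb1, hb2⟩ := ((hc.eventually_const_lt h1).and self_mem_nhdsWithin).exists
    exact ⟨b, hb2, hb1⟩
  filter_upwards [(hfg.tendsto x).eventually_lt_const hsum, hg x b hb] with x' h1 h2
  by_contra hcon
  have : y + b ≤ f x' + g x' := add_le_add (not_lt.1 hcon) h2.le
  exact absurd (this.trans h1.le) (not_le.2 hlt)

/-! ### Krylov–Bogoliubov -/

/-- Cesàro averages of the t-step laws are tight, so by Prokhorov they have a weak limit point; the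
averages are invariant up to O(1/n), and the Feller property passes this to the limit. -/
theorem exists_isStationary {X : Type*} [TopologicalSpace X] [T2Space X] [MeasurableSpace X]
    [BorelSpace X] [HasOuterApproxClosed X] (Q : Kernel X X) [IsMarkovKernel Q]
    (hQ : IsFeller Q) (x : X) (ht : IsTightMeasureSet (Set.range fun t : ℕ => (Q ^ t) x)) :
    ∃ ψ : Measure X, IsStationary Q ψ := by
  have hpow : ∀ t : ℕ, IsMarkovKernel (Q ^ t) := by
    intro t
    induction t with
    | zero => rw [pow_zero]; exact (inferInstance : IsMarkovKernel Kernel.id)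
    | succ t ih =>
      rw [pow_succ]
      exact (inferInstance : IsMarkovKernel ((Q ^ t) ∘ₖ Q))
  have hne : ∀ n : ℕ, ((n + 1 : ℕ) : ℝ≥0∞) ≠ 0 := fun n => by simp
  let m : ℕ → Measure X := fun n =>
    ((n + 1 : ℕ) : ℝ≥0∞)⁻¹ • ∑ t ∈ Finset.range (n + 1), (Q ^ t) x
  have hm : ∀ n, IsProbabilityMeasure (m n) := fun n => ⟨by
    simp only [m, Measure.smul_apply, Measure.finsetSum_apply, measure_univ, Finset.sum_const,
      Finset.card_range, smul_eq_mul, nsmul_eq_mul, mul_one]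
    exact ENNReal.inv_mul_cancel (hne n) (ENNReal.natCast_ne_top _)⟩
  let ψ : ℕ → ProbabilityMeasure X := fun n => ⟨m n, hm n⟩
  have htight : IsTightMeasureSet {((μ : ProbabilityMeasure X) : Measure X) | μ ∈ Set.range ψ} := by
    rw [isTightMeasureSet_iff_exists_isCompact_measure_compl_le] at ht ⊢
    intro ε hε
    obtain ⟨K, hK, hKε⟩ := ht ε hε
    refine ⟨K, hK, ?_⟩
    rintro _ ⟨_, ⟨n, rfl⟩, rfl⟩
    change m n Kᶜ ≤ ε
    simp only [m, Measure.smul_apply, Measure.finsetSum_apply, smul_eq_mul]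
    calc _ ≤ ((n + 1 : ℕ) : ℝ≥0∞)⁻¹ * ∑ t ∈ Finset.range (n + 1), ε := by
          gcongr with t ht
          exact hKε _ ⟨t, rfl⟩
      _ = ε := by
          rw [Finset.sum_const, Finset.card_range, nsmul_eq_mul, ← mul_assoc,
            ENNReal.inv_mul_cancel (hne n) (ENNReal.natCast_ne_top _), one_mul]
  have hcomp := isCompact_closure_of_isTightMeasureSet htight
  -- An ultrafilter finer than `atTop` gives the limit point from compactness alone, without
  -- extracting a subsequence.
  let U : Ultrafilter ℕ := Ultrafilter.of atTop
  have hU : (U : Filter ℕ) ≤ atTop := Ultrafilter.of_le _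
  obtain ⟨φ, -, hφ⟩ := hcomp.ultrafilter_le_nhds (U.map ψ) (by
    rw [le_principal_iff]
    exact Filter.mem_of_superset (Filter.range_mem_map) subset_closure)
  have hφ' : Tendsto ψ U (𝓝 φ) := hφ
  rw [ProbabilityMeasure.tendsto_iff_forall_integral_tendsto] at hφ'
  refine ⟨φ, inferInstance, ?_⟩
  rw [Kernel.Invariant]
  refine ext_of_forall_integral_eq_of_IsFiniteMeasure fun h => ?_
  have hintble : ∀ (μ : Measure X) [IsFiniteMeasure μ] (g : X →ᵇ ℝ), Integrable g μ :=
    fun μ _ g => g.integrable μ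
  let Qh : X →ᵇ ℝ := BoundedContinuousFunction.ofNormedAddCommGroup
    (fun y => ∫ w, h w ∂(Q y)) (hQ h) ‖h‖ (fun y => by
      refine (norm_integral_le_of_norm_le_const (C := ‖h‖)
        (Eventually.of_forall fun w => h.norm_coe_le_norm w)).trans ?_
      simp)
  have hbind : ∀ (μ : Measure X) [IsFiniteMeasure μ],
      ∫ y, h y ∂(μ.bind Q) = ∫ y, Qh y ∂μ := by
    intro μ _
    have hk : (Q ∘ₖ Kernel.const Unit μ) () = μ.bind Q := by
      rw [Kernel.comp_apply, Kernel.const_apply]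
    rw [← hk, Kernel.integral_comp (hintble _ h), Kernel.const_apply]
    rfl
  rw [hbind]
  have hstep : ∀ t : ℕ, ∫ y, Qh y ∂((Q ^ t) x) = ∫ y, h y ∂((Q ^ (t + 1)) x) := by
    intro t
    have : (Q ^ (t + 1)) x = ((Q ^ t) x).bind Q := by
      rw [pow_succ']
      exact Kernel.comp_apply _ _ _
    rw [this]
    exact (hbind _).symm
  have havg : ∀ (g : X →ᵇ ℝ) (n : ℕ), ∫ y, g y ∂(ψ n : Measure X) =
      ((n : ℝ) + 1)⁻¹ * ∑ t ∈ Finset.range (n + 1), ∫ y, g y ∂((Q ^ t) x) := by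
    intro g n
    change ∫ y, g y ∂(m n) = _
    simp only [m]
    rw [integral_smul_measure, integral_finsetSum_measure (fun t _ => hintble _ g), ENNReal.toReal_inv,
      ENNReal.toReal_natCast, smul_eq_mul]
    push_cast
    rfl
  -- The two averages differ by a shift of one period, so only the first and last terms survive, at
  -- most 2‖h‖/(n + 1).
  have hdiff : Tendsto (fun n => ∫ y, Qh y ∂(ψ n : Measure X) - ∫ y, h y ∂(ψ n : Measure X))
      atTop (𝓝 0) := by
    have heq : ∀ n, ∫ y, Qh y ∂(ψ n : Measure X) - ∫ y, h y ∂(ψ n : Measure X) =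
        ((n : ℝ) + 1)⁻¹ * (∫ y, h y ∂((Q ^ (n + 1)) x) - ∫ y, h y ∂((Q ^ 0) x)) := by
      intro n
      rw [havg, havg, ← mul_sub, ← Finset.sum_sub_distrib]
      simp_rw [hstep]
      rw [Finset.sum_range_sub (fun t => ∫ y, h y ∂((Q ^ t) x))]
    have hb : ∀ n : ℕ, ‖∫ y, Qh y ∂(ψ n : Measure X) - ∫ y, h y ∂(ψ n : Measure X)‖ ≤
        (1 / ((n : ℝ) + 1)) * (‖h‖ + ‖h‖) := by
      intro n
      rw [heq, norm_mul, norm_inv, one_div]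
      have hn : ‖(n : ℝ) + 1‖ = (n : ℝ) + 1 := by
        rw [Real.norm_eq_abs, abs_of_nonneg (by positivity)]
      have hk : ∀ t : ℕ, ‖∫ y, h y ∂((Q ^ t) x)‖ ≤ ‖h‖ := fun t => by
        refine (norm_integral_le_of_norm_le_const (C := ‖h‖)
          (Eventually.of_forall fun w => h.norm_coe_le_norm w)).trans ?_
        simp
      rw [hn]
      gcongr
      exact (norm_sub_le _ _).trans (add_le_add (hk _) (hk _))
    refine squeeze_zero_norm hb ?_
    simpa using tendsto_one_div_add_atTop_nhds_zero_nat.mul_const (‖h‖ + ‖h‖)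
  have := tendsto_nhds_unique (hdiff.mono_left hU) ((hφ' Qh).sub (hφ' h))
  linarith

end IncomeFluctuation

namespace IncomeFluctuation
namespace Model

variable {Z E H : Type*} [TopologicalSpace Z] [MeasurableSpace Z] [MeasurableSpace E]
  [MeasurableSpace H] (M : Model Z E H)

/-! ### The exogenous process -/

lemma pathLaw_map_eval_zero (z : Z) :
    (M.pathLaw z).map (fun ω => ω 0) = (Measure.dirac z).prod (M.ν.prod M.μ) := by
  have h : (fun ω : ℕ → Z × E × H => ω 0) =
      (MeasurableEquiv.piUnique (fun _ : Finset.Iic 0 => Z × E × H)) ∘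
        (Preorder.frestrictLe (π := fun _ => Z × E × H) 0) := by
    funext ω
    rfl
  rw [h, ← Measure.map_map (by fun_prop) (by fun_prop), pathLaw, Kernel.trajMeasure,
    Measure.map_comp _ _ (by fun_prop), Kernel.traj_map_frestrictLe, Kernel.partialTraj_self,
    Measure.id_comp, Measure.map_map (by fun_prop) (by fun_prop),
    MeasurableEquiv.self_comp_symm, Measure.map_id]

lemma Epath_eval_zero (z : Z) {f : Z → ℝ≥0∞} (hf : Measurable f) :
    M.Epath z (fun ω => f (ω 0).1) = f z := by
  have h : M.Epath z (fun ω => f (ω 0).1) =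
      ∫⁻ w : Z × E × H, f w.1 ∂((M.pathLaw z).map (fun ω => ω 0)) := by
    rw [lintegral_map (by fun_prop) (by fun_prop)]
    rfl
  rw [h, pathLaw_map_eval_zero, lintegral_prod _ (by fun_prop), lintegral_dirac']
  · simp
  · simpa using hf

instance (z : Z) : IsProbabilityMeasure (M.pathLaw z) := by
  unfold pathLaw
  infer_instance

/-- The Markov property of the exogenous process: if `F` depends on the path up to time `t` only,
then the shock at `t + 1` is integrated out by the shock kernel. -/
lemma Epath_succ {α : Type*} [MeasurableSpace α] (z : Z) (t : ℕ) {F : (ℕ → Z × E × H) → α}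
    (hF : Measurable F) (hFt : ∀ ω, F (fun i => ω (min i t)) = F ω)
    {g : α → Z × E × H → ℝ≥0∞} (hg : Measurable (Function.uncurry g)) :
    M.Epath z (fun ω => g (F ω) (ω (t + 1))) =
      M.Epath z (fun ω => M.E1 (ω t).1 (g (F ω))) := by
  -- A history up to t is extended to a full path by freezing it after t; by `hFt` this does not
  -- change `F`.
  let ext : ((i : Finset.Iic t) → Z × E × H) → ℕ → Z × E × H :=
    fun h i => h ⟨min i t, Finset.mem_Iic.2 (min_le_right _ _)⟩
  have hext : Measurable ext := by
    refine measurable_pi_lambda _ fun i => measurable_pi_apply _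
  let G : ((i : Finset.Iic t) → Z × E × H) × (Z × E × H) → ℝ≥0∞ :=
    fun p => g (F (ext p.1)) p.2
  have hG : Measurable G := hg.comp ((hF.comp (hext.comp measurable_fst)).prodMk measurable_snd)
  have hval : ∀ ω, F (ext (Preorder.frestrictLe t ω)) = F ω := fun ω => hFt ω
  let κ : (n : ℕ) → Kernel ((i : Finset.Iic n) → Z × E × H) (Z × E × H) := fun n =>
    M.shock.comap (fun h => (h ⟨n, Finset.mem_Iic.2 le_rfl⟩).1) (by fun_prop)
  have key := Kernel.map_frestrictLe_trajMeasure_compProd_eq_map_trajMeasure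
    (X := fun _ => Z × E × H) (μ₀ := (Measure.dirac z).prod (M.ν.prod M.μ)) (κ := κ) (a := t)
  have hpl : Kernel.trajMeasure (X := fun _ => Z × E × H)
    ((Measure.dirac z).prod (M.ν.prod M.μ)) κ = M.pathLaw z := rfl
  rw [hpl] at key
  have h1 : M.Epath z (fun ω => g (F ω) (ω (t + 1))) =
      ∫⁻ p, G p ∂((M.pathLaw z).map fun ω => (Preorder.frestrictLe t ω, ω (t + 1))) := by
    rw [lintegral_map hG (by fun_prop)]
    simp only [G, hval]
    rfl
  rw [h1, ← key, Measure.lintegral_compProd hG,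
    lintegral_map (hG.lintegral_kernel_prod_right') (by fun_prop)]
  refine lintegral_congr fun ω => ?_
  simp only [G, hval]
  rfl

/-- The state at time `s ≤ t` depends on the path up to time `t` only. -/
lemma state_min_eq (c : Policy Z) (a : ℝ≥0) (ω : ℕ → Z × E × H) (t : ℕ) :
    ∀ s ≤ t, M.state c a (fun i => ω (min i t)) s = M.state c a ω s := by
  intro s
  induction s with
  | zero => intro _; simp [state]
  | succ s ih =>
    intro hs
    simp only [state]
    rw [ih (by omega), min_eq_left hs]

lemma state_snd (c : Policy Z) (a : ℝ≥0) (ω : ℕ → Z × E × H) (t : ℕ) :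
    (M.state c a ω t).2 = (ω t).1 := by
  cases t <;> rfl

lemma measurable_state (c : Policy Z) (a : ℝ≥0) (t : ℕ) :
    Measurable fun ω : ℕ → Z × E × H => M.state c a ω t := by
  induction t with
  | zero => simp only [state]; fun_prop
  | succ t ih =>
    simp only [state]
    exact (M.measurable_step c).comp (ih.prodMk (measurable_pi_apply _))

lemma measurable_E1 {α : Type*} [MeasurableSpace α] {z : α → Z} (hz : Measurable z)
    {g : α → Z × E × H → ℝ≥0∞} (hg : Measurable (Function.uncurry g)) :
    Measurable fun x => M.E1 (z x) (g x) := by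
  have : Measurable (Function.uncurry g) := hg
  exact Measurable.lintegral_kernel_prod_right' (κ := M.shock.comap z hz) hg

lemma measurable_E1_const {g : Z × E × H → ℝ≥0∞} (hg : Measurable g) :
    Measurable fun z => M.E1 z g :=
  M.measurable_E1 measurable_id (g := fun _ => g) (hg.comp measurable_snd)

lemma Epath_state_zero (c : Policy Z) (a : ℝ≥0) (z : Z) {f : ℝ≥0 × Z → ℝ≥0∞}
    (hf : Measurable f) : M.Epath z (fun ω => f (M.state c a ω 0)) = f (a, z) :=
  M.Epath_eval_zero z (f := fun z => f (a, z)) (by fun_prop)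

lemma Epath_state_succ (c : Policy Z) (a : ℝ≥0) (z : Z) (t : ℕ)
    {g : ℝ≥0 × Z → Z × E × H → ℝ≥0∞} (hg : Measurable (Function.uncurry g)) :
    M.Epath z (fun ω => g (M.state c a ω t) (ω (t + 1))) =
      M.Epath z (fun ω => M.E1 (M.state c a ω t).2 (g (M.state c a ω t))) := by
  simp_rw [state_snd]
  exact M.Epath_succ z t (M.measurable_state c a t) (fun ω => M.state_min_eq c a ω t t le_rfl) hg

/-- The link between the path description, in which moments are computed, and the powers of
`stateKernel`, in which tightness is stated. -/
lemma Epath_state_eq (c : Policy Z) (a : ℝ≥0) (z : Z) (t : ℕ) :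
    ∀ {f : ℝ≥0 × Z → ℝ≥0∞}, Measurable f →
    M.Epath z (fun ω => f (M.state c a ω t)) = ∫⁻ s, f s ∂((M.stateKernel c) ^ t) (a, z) := by
  induction t with
  | zero =>
    intro f hf
    rw [M.Epath_state_zero c a z hf, pow_zero]
    exact (Kernel.lintegral_id' hf (a, z)).symm
  | succ t ih =>
    intro f hf
    have hg : Measurable (Function.uncurry fun (s : ℝ≥0 × Z) (w : Z × E × H) =>
      f (M.step c s w)) := hf.comp (M.measurable_step c)
    have h1 := M.Epath_state_succ c a z t hg
    rw [show M.Epath z (fun ω => f (M.state c a ω (t + 1))) = _ from h1,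
      ih (f := fun s => M.E1 s.2 (fun w => f (M.step c s w))) (M.measurable_E1 measurable_snd hg),
      pow_succ']
    change _ = ∫⁻ s, f s ∂((M.stateKernel c) ∘ₖ (M.stateKernel c ^ t)) (a, z)
    rw [Kernel.lintegral_comp _ _ _ hf]
    refine lintegral_congr fun s => ?_
    have hs : Measurable (M.step c s) := (M.measurable_step c).comp measurable_prodMk_left
    rw [stateKernel_apply, lintegral_map hf hs]
    rfl

lemma E1_fst (z : Z) {f : Z → ℝ≥0∞} (hf : Measurable f) :
    M.E1 z (fun w => f w.1) = ∫⁻ y, f y ∂(M.P z) := by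
  rw [E1, shock, Kernel.prod_apply, Kernel.const_apply, lintegral_prod _ (by fun_prop)]
  simp

lemma Epath_eval_fst_eq (z : Z) (t : ℕ) : ∀ {f : Z → ℝ≥0∞}, Measurable f →
    M.Epath z (fun ω => f (ω t).1) = ∫⁻ y, f y ∂(M.P ^ t) z := by
  induction t with
  | zero =>
    intro f hf
    rw [M.Epath_eval_zero z hf, pow_zero]
    exact (Kernel.lintegral_id' hf z).symm
  | succ t ih =>
    intro f hf
    have h1 := M.Epath_succ z t (F := fun _ => ()) measurable_const (fun _ => rfl)
      (g := fun _ w => f w.1) (by fun_prop)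
    rw [h1, ih (f := fun z => M.E1 z fun w => f w.1)
      (M.measurable_E1_const (hf.comp measurable_fst)), pow_succ']
    change _ = ∫⁻ s, f s ∂(M.P ∘ₖ (M.P ^ t)) z
    rw [Kernel.lintegral_comp _ _ _ hf]
    exact lintegral_congr fun y => M.E1_fst y hf

lemma expInc_succ (t : ℕ) (z : Z) :
    M.expInc (t + 1) z = M.Epath z (fun ω => M.E1 (ω t).1 fun w => M.inc w) :=
  M.Epath_succ z t (F := fun _ => ()) measurable_const (fun _ => rfl)
    (g := fun _ w => M.inc w) (M.measurable_inc.coe_nnreal_ennreal.comp measurable_snd)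

/-! ### The return operator and the weights that make it contract -/

/-- `𝔼_z R̂ f(ẑ)`. -/
def retOp (f : Z → ℝ≥0∞) (z : Z) : ℝ≥0∞ := M.E1 z fun w => M.ret w * f w.1

lemma measurable_ret_mul {f : Z → ℝ≥0∞} (hf : Measurable f) :
    Measurable fun w : Z × E × H => (M.ret w : ℝ≥0∞) * f w.1 :=
  M.measurable_ret.coe_nnreal_ennreal.mul (hf.comp measurable_fst)

lemma measurable_retOp {f : Z → ℝ≥0∞} (hf : Measurable f) : Measurable (M.retOp f) :=
  M.measurable_E1_const (M.measurable_ret_mul hf)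

lemma measurable_retOp_iterate (n : ℕ) : Measurable (M.retOp^[n] 1) := by
  induction n with
  | zero => exact measurable_one
  | succ n ih =>
    rw [Function.iterate_succ_apply']
    exact M.measurable_retOp ih

/-- The Markov property integrates out the last return first, turning f into `retOp f`; hence the
induction must be uniform in f. -/
lemma Epath_prod_ret (z : Z) (n : ℕ) : ∀ {f : Z → ℝ≥0∞}, Measurable f →
    M.Epath z (fun ω => (∏ i ∈ Finset.Icc 1 n, (M.ret (ω i) : ℝ≥0∞)) * f (ω n).1) =
      M.retOp^[n] f z := by
  induction n with
  | zero =>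
    intro f hf
    simpa using M.Epath_eval_zero z hf
  | succ n ih =>
    intro f hf
    have hret := M.measurable_ret.coe_nnreal_ennreal
    have h1 := M.Epath_succ z n
      (F := fun ω => ∏ i ∈ Finset.Icc 1 n, (M.ret (ω i) : ℝ≥0∞))
      (Finset.measurable_fun_prod _ fun i _ => hret.comp (measurable_pi_apply i))
      (fun ω => Finset.prod_congr rfl fun i hi => by
        simp only [min_eq_left (Finset.mem_Icc.1 hi).2])
      (g := fun x w => x * (M.ret w * f w.1))
      (measurable_fst.mul ((hret.comp measurable_snd).mul
        (hf.comp (measurable_fst.comp measurable_snd))))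
    rw [Function.iterate_succ_apply, ← ih (M.measurable_retOp hf)]
    simp_rw [Finset.prod_Icc_succ_top (Nat.succ_le_succ (Nat.zero_le n)), mul_assoc]
    rw [h1]
    congr 1
    funext ω
    exact lintegral_const_mul _ (M.measurable_ret_mul hf)

lemma expRetProd_eq (n : ℕ) (z : Z) : M.expRetProd n z = M.retOp^[n] 1 z := by
  rw [← M.Epath_prod_ret z n measurable_one]
  simp [expRetProd]

lemma retOp_mono {f g : Z → ℝ≥0∞} (h : f ≤ g) : M.retOp f ≤ M.retOp g :=
  fun z => lintegral_mono fun w => by gcongr; exact h w.1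

lemma retOp_const_mul {f : Z → ℝ≥0∞} (hf : Measurable f) (r : ℝ≥0∞) (z : Z) :
    M.retOp (fun z => r * f z) z = r * M.retOp f z := by
  unfold retOp E1
  rw [← lintegral_const_mul _ (M.measurable_ret_mul hf)]
  refine lintegral_congr fun w => ?_
  simp only
  ring

lemma retOp_sum {ι : Type*} (s : Finset ι) {f : ι → Z → ℝ≥0∞} (hf : ∀ i, Measurable (f i))
    (z : Z) : M.retOp (fun z => ∑ i ∈ s, f i z) z = ∑ i ∈ s, M.retOp (f i) z := by
  unfold retOp E1
  rw [← lintegral_finsetSum _ fun i _ => M.measurable_ret_mul (hf i)]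
  refine lintegral_congr fun w => ?_
  simp only
  rw [Finset.mul_sum]

lemma exists_retOp_iterate_le (hbd : M.BoundedMoments) (n : ℕ) :
    ∃ B : ℝ≥0∞, B < ⊤ ∧ ∀ z, M.retOp^[n] 1 z ≤ B := by
  induction n with
  | zero => exact ⟨1, ENNReal.one_lt_top, fun z => le_rfl⟩
  | succ n ih =>
    obtain ⟨B, hB, hle⟩ := ih
    refine ⟨B * ⨆ z, M.E1 z (fun w => M.ret w), ENNReal.mul_lt_top hB hbd.ret, fun z => ?_⟩
    rw [Function.iterate_succ_apply']
    refine (M.retOp_mono (g := fun _ => B * 1) (fun z => by simpa using hle z) z).trans ?_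
    rw [M.retOp_const_mul measurable_const]
    gcongr
    simpa [retOp] using le_iSup (fun z => M.E1 z (fun w => M.ret w)) z

/-- A bounded weight for which the discounted return operator is a strict contraction. -/
lemma exists_weight (hbd : M.BoundedMoments) {θ : ℝ≥0} {n : ℕ} (hn : 1 ≤ n)
    (h : (θ : ℝ≥0∞) ^ n * (⨆ z, M.expRetProd n z) < 1) :
    ∃ (κ : Z → ℝ≥0∞) (l : ℝ≥0) (B : ℝ≥0∞), Measurable κ ∧ l < 1 ∧ B < ⊤ ∧
      (∀ z, 1 ≤ κ z) ∧ (∀ z, κ z ≤ B) ∧ ∀ z, θ * M.retOp κ z ≤ l * κ z := by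
  obtain ⟨l, hl0, hl1, hl⟩ : ∃ l : ℝ≥0, 0 < l ∧ l < 1 ∧
      (θ : ℝ≥0∞) ^ n * (⨆ z, M.expRetProd n z) ≤ (l : ℝ≥0∞) ^ n := by
    have hc : Tendsto (fun l : ℝ≥0 => (l : ℝ≥0∞) ^ n) (𝓝[<] 1) (𝓝 1) := by
      have : Tendsto (fun l : ℝ≥0 => ((l ^ n : ℝ≥0) : ℝ≥0∞)) (𝓝[<] 1) (𝓝 ((1 ^ n : ℝ≥0) : ℝ≥0∞)) :=
        ENNReal.tendsto_coe.2 (((continuous_pow n).tendsto 1).mono_left nhdsWithin_le_nhds)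
      simpa using this
    have hpos : ∀ᶠ l : ℝ≥0 in 𝓝[<] 1, 0 < l :=
      nhdsWithin_le_nhds (lt_mem_nhds zero_lt_one)
    have : (𝓝[<] (1 : ℝ≥0)).NeBot := nhdsLT_neBot_of_exists_lt ⟨0, zero_lt_one⟩
    obtain ⟨l, ⟨h1, h2⟩, h3⟩ :=
      (((hc.eventually_const_lt h).and hpos).and self_mem_nhdsWithin).exists
    exact ⟨l, h2, h3, h1.le⟩
  -- The weight is κ = ∑_{i<n} qⁱ `retOp`ⁱ 1. Applying θ · `retOp` = l q · `retOp` shifts the sum by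
  -- one index: the term 1 is lost and qⁿ `retOp`ⁿ 1 is gained, and the latter is at most 1 by the
  -- choice of l.
  set q : ℝ≥0 := θ / l with hq
  have hθ : (θ : ℝ≥0∞) = l * q := by
    rw [← ENNReal.coe_mul, hq, mul_div_cancel₀ _ hl0.ne']
  choose B hB hBle using M.exists_retOp_iterate_le hbd
  have hmeas : ∀ i, Measurable fun z => (q : ℝ≥0∞) ^ i * M.retOp^[i] 1 z := fun i =>
    (M.measurable_retOp_iterate i).const_mul _
  refine ⟨fun z => ∑ i ∈ Finset.range n, (q : ℝ≥0∞) ^ i * M.retOp^[i] 1 z, l,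
    ∑ i ∈ Finset.range n, (q : ℝ≥0∞) ^ i * B i, Finset.measurable_fun_sum _ fun i _ => hmeas i, hl1,
    ?_, fun z => ?_, fun z => ?_, fun z => ?_⟩
  · exact ENNReal.sum_lt_top.2 fun i _ => ENNReal.mul_lt_top (by finiteness) (hB i)
  · have := Finset.single_le_sum (f := fun i => (q : ℝ≥0∞) ^ i * M.retOp^[i] 1 z)
      (fun i _ => zero_le) (Finset.mem_range.2 hn)
    simpa using this
  · exact Finset.sum_le_sum fun i _ => by gcongr; exact hBle i z
  · rw [M.retOp_sum _ hmeas, hθ, mul_assoc]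
    gcongr
    rw [Finset.mul_sum]
    have h1 : ∀ i, (q : ℝ≥0∞) * M.retOp (fun z => (q : ℝ≥0∞) ^ i * M.retOp^[i] 1 z) z =
        (q : ℝ≥0∞) ^ (i + 1) * M.retOp^[i + 1] 1 z := by
      intro i
      rw [M.retOp_const_mul (M.measurable_retOp_iterate i), Function.iterate_succ_apply', pow_succ']
      ring
    simp_rw [h1]
    have hlast : (q : ℝ≥0∞) ^ n * M.retOp^[n] 1 z ≤ 1 := by
      have h2 : (l : ℝ≥0∞) ^ n * ((q : ℝ≥0∞) ^ n * M.retOp^[n] 1 z) ≤ (l : ℝ≥0∞) ^ n * 1 := by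
        rw [← mul_assoc, ← mul_pow, ← hθ, mul_one, ← expRetProd_eq]
        exact le_trans (by gcongr; exact le_iSup (M.expRetProd n) z) hl
      exact (ENNReal.mul_le_mul_iff_right (by simp [hl0.ne']) (by finiteness)).1 h2
    have h3 := Finset.sum_range_succ (fun i => (q : ℝ≥0∞) ^ i * M.retOp^[i] 1 z) n
    rw [Finset.sum_range_succ' _ n] at h3
    have h4 : ∑ i ∈ Finset.range n, (q : ℝ≥0∞) ^ (i + 1) * M.retOp^[i + 1] 1 z + 1 =
        ∑ i ∈ Finset.range n, (q : ℝ≥0∞) ^ i * M.retOp^[i] 1 z +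
          (q : ℝ≥0∞) ^ n * M.retOp^[n] 1 z := by simpa using h3
    refine (ENNReal.add_le_add_iff_right ENNReal.one_ne_top).1 ?_
    rw [h4]
    gcongr

/-- Growth of weighted wealth under a policy that saves at most the fraction `ρ`. -/
lemma Epath_wealth_succ_le (c : Policy Z) {ρ : ℝ≥0} (hρ : ∀ s, s.1 - c.toFun s ≤ ρ * s.1)
    {κ : Z → ℝ≥0∞} (hκ : Measurable κ) {B : ℝ≥0∞} (hB : ∀ z, κ z ≤ B) (a : ℝ≥0) (z : Z) (t : ℕ) :
    M.Epath z (fun ω => (M.state c a ω (t + 1)).1 * κ (M.state c a ω (t + 1)).2) ≤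
      M.Epath z (fun ω => (M.state c a ω t).1 * (ρ * M.retOp κ (M.state c a ω t).2)) +
        B * M.expInc (t + 1) z := by
  have hret := M.measurable_ret.coe_nnreal_ennreal
  have hinc := M.measurable_inc.coe_nnreal_ennreal
  have hst := M.measurable_step c
  have hg : Measurable (Function.uncurry fun (s : ℝ≥0 × Z) (w : Z × E × H) =>
      ((M.step c s w).1 : ℝ≥0∞) * κ (M.step c s w).2) := by
    exact (measurable_fst.comp hst).coe_nnreal_ennreal.mul (hκ.comp (measurable_snd.comp hst))
  refine (M.Epath_state_succ c a z t hg).le.trans ?_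
  have hmeas : Measurable fun ω : ℕ → Z × E × H =>
      ((M.state c a ω t).1 : ℝ≥0∞) * (ρ * M.retOp κ (M.state c a ω t).2) := by
    have := M.measurable_state c a t
    have h2 := (M.measurable_retOp hκ).comp (measurable_snd.comp this)
    exact (measurable_fst.comp this).coe_nnreal_ennreal.mul (h2.const_mul _)
  have hy : Measurable fun ω : ℕ → Z × E × H => M.E1 (ω t).1 fun w => M.inc w :=
    (M.measurable_E1_const hinc).comp (by fun_prop)
  rw [expInc_succ]
  unfold Epath
  rw [← lintegral_const_mul _ hy, ← lintegral_add_left hmeas]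
  refine lintegral_mono fun ω => ?_
  simp only [state_snd]
  set x := M.state c a ω t
  unfold retOp E1
  have hrk := M.measurable_ret_mul hκ
  rw [← lintegral_const_mul _ hrk, ← lintegral_const_mul _ hinc,
    ← lintegral_const_mul _ (hrk.const_mul _),
    ← lintegral_add_left ((hrk.const_mul _).const_mul _)]
  refine lintegral_mono fun w => ?_
  simp only [step]
  have h1 : ((x.1 - c.toFun x : ℝ≥0) : ℝ≥0∞) ≤ ρ * x.1 := by exact_mod_cast hρ x
  calc ((M.ret w * (x.1 - c.toFun x) + M.inc w : ℝ≥0) : ℝ≥0∞) * κ w.1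
      = M.ret w * ((x.1 - c.toFun x : ℝ≥0) : ℝ≥0∞) * κ w.1 + κ w.1 * M.inc w := by
        push_cast
        ring
    _ ≤ M.ret w * (ρ * x.1) * κ w.1 + B * M.inc w := by
        gcongr
        exact hB w.1
    _ = _ := by ring

end Model
end IncomeFluctuation

namespace IncomeFluctuation
namespace Model

variable {Z E H : Type*} [TopologicalSpace Z] [MeasurableSpace Z] [MeasurableSpace E]
  [MeasurableSpace H] {M : Model Z E H}

/-! ### Utility -/

@[simp] lemma u'_zero : M.u' 0 = ⊤ := by simp [u']

lemma u'_of_pos {x : ℝ≥0} (hx : 0 < x) : M.u' x = ENNReal.ofReal (deriv M.uReal x) := by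
  simp [u', hx.ne']

lemma u'_ne_top {x : ℝ≥0} (hx : 0 < x) : M.u' x ≠ ⊤ := by
  rw [u'_of_pos hx]
  exact ENNReal.ofReal_ne_top

namespace Utility

lemma u'_pos (hu : M.Utility) (x : ℝ≥0) : 0 < M.u' x := by
  rcases eq_or_ne x 0 with rfl | hx
  · simp
  · rw [u'_of_pos (pos_iff_ne_zero.2 hx)]
    exact ENNReal.ofReal_pos.2 (hu.deriv_pos _ (NNReal.coe_pos.2 (pos_iff_ne_zero.2 hx)))

lemma strictAntiOn_deriv (hu : M.Utility) : StrictAntiOn (deriv M.uReal) (Set.Ioi 0) :=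
  strictAntiOn_of_deriv_neg (convex_Ioi 0)
    (fun x hx => (hu.differentiable_deriv x hx).continuousAt.continuousWithinAt)
    (fun x hx => hu.deriv2_neg x (by simpa using hx))

lemma strictAnti_u' (hu : M.Utility) : StrictAnti M.u' := by
  intro x y hxy
  have hy : 0 < y := lt_of_le_of_lt _root_.zero_le hxy
  rcases eq_or_ne x 0 with rfl | hx
  · rw [u'_zero]
    exact lt_top_iff_ne_top.2 (u'_ne_top hy)
  · have hx' : 0 < x := pos_iff_ne_zero.2 hx
    rw [u'_of_pos hx', u'_of_pos hy]
    exact (ENNReal.ofReal_lt_ofReal_iff (hu.deriv_pos _ (NNReal.coe_pos.2 hx'))).2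
      (hu.strictAntiOn_deriv (NNReal.coe_pos.2 hx') (NNReal.coe_pos.2 hy)
        (NNReal.coe_lt_coe.2 hxy))

lemma continuous_u' (hu : M.Utility) : Continuous M.u' := by
  rw [continuous_iff_continuousAt]
  intro x
  rcases eq_or_ne x 0 with rfl | hx
  · rw [ContinuousAt, u'_zero, ENNReal.tendsto_nhds_top_iff_nnreal]
    intro K
    have h1 : ∀ᶠ y in 𝓝[>] (0 : ℝ), (K : ℝ) < deriv M.uReal y :=
      hu.tendsto_zero.eventually_gt_atTop (K : ℝ)
    have h2 : ∀ᶠ y in 𝓝 (0 : ℝ), 0 < y → (K : ℝ) < deriv M.uReal y := by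
      rwa [eventually_nhdsWithin_iff] at h1
    have h3 : Tendsto (fun y : ℝ≥0 => (y : ℝ)) (𝓝 0) (𝓝 0) :=
      NNReal.continuous_coe.tendsto' 0 0 rfl
    filter_upwards [h3.eventually h2] with y hy
    rcases eq_or_ne y 0 with rfl | hy0
    · simp
    · have hy' : 0 < y := pos_iff_ne_zero.2 hy0
      rw [u'_of_pos hy']
      have := hy (NNReal.coe_pos.2 hy')
      rw [← ENNReal.ofReal_coe_nnreal]
      exact (ENNReal.ofReal_lt_ofReal_iff (lt_of_le_of_lt K.2 this)).2 this
  · have hx' : 0 < x := pos_iff_ne_zero.2 hx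
    have h1 : ContinuousAt (fun y : ℝ≥0 => ENNReal.ofReal (deriv M.uReal y)) x :=
      ENNReal.continuous_ofReal.continuousAt.comp
        (ContinuousAt.comp (f := fun y : ℝ≥0 => (y : ℝ))
          (hu.differentiable_deriv x (NNReal.coe_pos.2 hx')).continuousAt
          NNReal.continuous_coe.continuousAt)
    refine h1.congr ?_
    filter_upwards [lt_mem_nhds hx'] with y hy
    rw [u'_of_pos hy]

lemma exists_u'_eq (hu : M.Utility) {y : ℝ≥0∞} (hy : 0 < y) : ∃ x, M.u' x = y := by
  rcases eq_or_ne y ⊤ with rfl | hyt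
  · exact ⟨0, u'_zero⟩
  have h1 : ∃ x, M.u' x ≤ y := by
    have h2 : ∀ᶠ x in atTop, deriv M.uReal x < y.toReal :=
      hu.tendsto_top.eventually_lt_const (ENNReal.toReal_pos hy.ne' hyt)
    obtain ⟨x, hx, hx0⟩ := (h2.and (eventually_gt_atTop 0)).exists
    refine ⟨⟨x, hx0.le⟩, ?_⟩
    rw [u'_of_pos (show (0 : ℝ≥0) < ⟨x, hx0.le⟩ from hx0), ← ENNReal.ofReal_toReal hyt]
    exact ENNReal.ofReal_le_ofReal hx.le
  exact mem_range_of_exists_le_of_exists_ge hu.continuous_u' h1 ⟨0, by simp⟩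

lemma u_eq_uReal (hu : M.Utility) {x : ℝ≥0} (hx : 0 < x) : M.u x = (M.uReal x : EReal) := by
  rw [uReal, Real.toNNReal_coe, EReal.coe_toReal (hu.ne_top x) (hu.ne_bot x hx)]

lemma uReal_lt_tangent (hu : M.Utility) {x y : ℝ} (hx : 0 < x) (hy : 0 < y) (hxy : y ≠ x) :
    M.uReal y < M.uReal x + deriv M.uReal x * (y - x) := by
  have hcont : ∀ a b : ℝ, 0 < a → ContinuousOn M.uReal (Set.Icc a b) := fun a b ha t ht =>
    (hu.differentiable t (ha.trans_le ht.1)).continuousAt.continuousWithinAt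
  have hdiff : ∀ a b : ℝ, 0 < a → DifferentiableOn ℝ M.uReal (Set.Ioo a b) := fun a b ha t ht =>
    (hu.differentiable t (ha.trans ht.1)).differentiableWithinAt
  rcases lt_or_gt_of_ne hxy with h | h
  · obtain ⟨ξ, hξ, hξe⟩ := exists_deriv_eq_slope M.uReal h (hcont _ _ hy) (hdiff _ _ hy)
    have h1 := hu.strictAntiOn_deriv (hy.trans hξ.1) hx hξ.2
    rw [hξe, lt_div_iff₀ (by linarith)] at h1
    linarith
  · obtain ⟨ξ, hξ, hξe⟩ := exists_deriv_eq_slope M.uReal h (hcont _ _ hx) (hdiff _ _ hx)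
    have h1 := hu.strictAntiOn_deriv hx (hx.trans hξ.1) hξ.1
    rw [hξe, div_lt_iff₀ (by linarith)] at h1
    linarith

/-- For d > 0 this is strict concavity on (0, ∞). At d = 0 continuity of u is not assumed; only u(0)
≤ u(x) is available. -/
lemma lt_tangent (hu : M.Utility) {c d : ℝ≥0} (hc : 0 < c) (hcd : d ≠ c) {s : ℝ}
    (hs : M.u d = (s : EReal)) :
    s < M.uReal c + deriv M.uReal c * ((d : ℝ) - c) := by
  rcases eq_or_ne d 0 with rfl | hd
  · have hc' : (0 : ℝ) < c := NNReal.coe_pos.2 hc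
    -- Letting x → 0 in the tangent inequality at b loses strictness. It is recovered from the
    -- strict tangent inequality at c, evaluated at b, together with u'(c) < u'(b).
    set b : ℝ := c / 2 with hb
    have hb0 : 0 < b := by positivity
    have h1 : s ≤ M.uReal b + deriv M.uReal b * (0 - b) := by
      refine le_of_forall_pos_lt_add fun ε hε => ?_
      have hD := hu.deriv_pos b hb0
      obtain ⟨x, hx0, hxb, hxε⟩ : ∃ x : ℝ, 0 < x ∧ x < b ∧ deriv M.uReal b * x ≤ ε := by
        refine ⟨min (b / 2) (ε / deriv M.uReal b), by positivity,
          (min_le_left _ _).trans_lt (by linarith), ?_⟩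
        calc _ ≤ deriv M.uReal b * (ε / deriv M.uReal b) := by gcongr; exact min_le_right _ _
          _ = ε := by field_simp
      have h2 : s ≤ M.uReal x := by
        have := hu.zero_le x.toNNReal
        rw [hs, hu.u_eq_uReal (Real.toNNReal_pos.2 hx0), Real.coe_toNNReal _ hx0.le] at this
        exact_mod_cast this
      have h3 := hu.uReal_lt_tangent hb0 hx0 hxb.ne
      nlinarith
    have h2 := hu.uReal_lt_tangent hc' hb0 (by rw [hb]; linarith)
    have h3 := hu.strictAntiOn_deriv (a := b) hb0 hc' (by rw [hb]; linarith)
    have h4 : (c : ℝ) = 2 * b := by rw [hb]; ring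
    rw [NNReal.coe_zero]
    nlinarith
  · have hd' : 0 < d := pos_iff_ne_zero.2 hd
    rw [hu.u_eq_uReal hd'] at hs
    have hs' : M.uReal d = s := by exact_mod_cast hs
    rw [← hs']
    exact hu.uReal_lt_tangent (NNReal.coe_pos.2 hc) (NNReal.coe_pos.2 hd')
      (fun h => hcd (NNReal.coe_injective h))

/-- The tangent inequality u(d) + δ ≤ u(c) + u'(c)(d - c), with u split into positive and negative
parts and every term moved to the side where its sign is positive. In this form it can be integrated
before anything is known to be finite. -/
lemma concave_strict (hu : M.Utility) {c d : ℝ≥0} (hc : 0 < c) (hcd : d ≠ c) :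
    ∃ δ : ℝ≥0∞, 0 < δ ∧
      (M.u d).toENNReal + (-M.u c).toENNReal + M.u' c * c + δ ≤
        (M.u c).toENNReal + (-M.u d).toENNReal + M.u' c * d := by
  rcases eq_or_ne (M.u d) ⊥ with hd | hd
  · exact ⟨1, one_pos, by simp [hd]⟩
  set s := (M.u d).toReal
  have hs : M.u d = (s : EReal) := (EReal.coe_toReal (hu.ne_top d) hd).symm
  have h := hu.lt_tangent hc hcd hs
  set r := M.uReal c
  have hr : M.u c = (r : EReal) := hu.u_eq_uReal hc
  set D := deriv M.uReal c with hD
  have hD0 : 0 < D := hu.deriv_pos c (NNReal.coe_pos.2 hc)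
  set δ := r + D * ((d : ℝ) - c) - s with hδ
  have hδ0 : 0 < δ := by rw [hδ]; linarith
  refine ⟨ENNReal.ofReal δ, ENNReal.ofReal_pos.2 hδ0, ?_⟩
  have hpos : ∀ x : ℝ, (x : EReal).toENNReal = ENNReal.ofReal (max x 0) := fun x => by
    rw [EReal.toENNReal_of_ne_top (EReal.coe_ne_top x), EReal.toReal_coe]
    simp
  rw [hs, hr, u'_of_pos hc, ← EReal.coe_neg, ← EReal.coe_neg, hpos, hpos, hpos, hpos,
    ← ENNReal.ofReal_coe_nnreal (p := c), ← ENNReal.ofReal_coe_nnreal (p := d),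
    ← ENNReal.ofReal_mul hD0.le, ← ENNReal.ofReal_mul hD0.le]
  have m1 := le_max_right s 0
  have m2 := le_max_right (-s) 0
  have m3 := le_max_right r 0
  have m4 := le_max_right (-r) 0
  have c0 : 0 ≤ D * c := by positivity
  have d0 : 0 ≤ D * d := by positivity
  have e1 : max s 0 - max (-s) 0 = s := by
    rcases le_total 0 s with h | h <;> simp [h]
  have e2 : max r 0 - max (-r) 0 = r := by
    rcases le_total 0 r with h | h <;> simp [h]
  rw [← ENNReal.ofReal_add (by positivity) (by positivity),
    ← ENNReal.ofReal_add (by positivity) (by positivity),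
    ← ENNReal.ofReal_add (by positivity) (by positivity),
    ← ENNReal.ofReal_add (by positivity) (by positivity),
    ← ENNReal.ofReal_add (by positivity) (by positivity)]
  refine ENNReal.ofReal_le_ofReal ?_
  rw [hδ]
  linarith

lemma concave (hu : M.Utility) (c d : ℝ≥0) :
    (M.u d).toENNReal + (-M.u c).toENNReal + M.u' c * c ≤
      (M.u c).toENNReal + (-M.u d).toENNReal + M.u' c * d := by
  rcases eq_or_ne d c with rfl | hcd
  · rfl
  rcases eq_or_ne c 0 with rfl | hc
  · simp [hcd]
  · obtain ⟨δ, -, h⟩ := hu.concave_strict (pos_iff_ne_zero.2 hc) hcd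
    exact le_self_add.trans h

lemma toENNReal_u_le (hu : M.Utility) (x : ℝ≥0) :
    (M.u x).toENNReal ≤ (M.u 1).toENNReal + M.u' 1 * x := by
  rcases le_total (M.u x) 0 with h | h
  · rw [EReal.toENNReal_of_nonpos h]
    exact _root_.zero_le
  · have h1 := hu.concave 1 x
    have h2 : (-M.u x).toENNReal = 0 := EReal.toENNReal_of_nonpos (by simpa using h)
    rw [h2, add_zero] at h1
    exact le_self_add.trans (le_self_add.trans h1)

/-- The tangent at y evaluated at 1. Applied to y = Y_t it bounds the disutility of consuming income
only. -/
lemma toENNReal_neg_u_le (hu : M.Utility) (y : ℝ≥0) :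
    (-M.u y).toENNReal ≤ (-M.u 1).toENNReal + M.u' y := by
  rcases le_total 0 (M.u y) with h | h
  · rw [EReal.toENNReal_of_nonpos (by simpa using h)]
    exact _root_.zero_le
  · have h1 := hu.concave y 1
    rw [EReal.toENNReal_of_nonpos h, zero_add, ENNReal.coe_one, mul_one] at h1
    exact le_add_self.trans (le_self_add.trans h1)

lemma toENNReal_u_ne_top (hu : M.Utility) (x : ℝ≥0) : (M.u x).toENNReal ≠ ⊤ := by
  rw [Ne, EReal.toENNReal_eq_top_iff]
  exact hu.ne_top x

lemma toENNReal_neg_u_ne_top (hu : M.Utility) {x : ℝ≥0} (hx : 0 < x) :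
    (-M.u x).toENNReal ≠ ⊤ := by
  rw [Ne, EReal.toENNReal_eq_top_iff, EReal.neg_eq_top_iff]
  exact hu.ne_bot x hx

/-- Either a ≤ 1, and the first term suffices, or a ≥ 1, and the second does. With y the current
income this controls u'(a)a, the quantity in the transversality condition. -/
lemma u'_mul_le (hu : M.Utility) {y a : ℝ≥0} (h : y ≤ a) :
    M.u' a * a ≤ M.u' y + M.u' 1 * a := by
  rcases le_total a 1 with ha | ha
  · calc M.u' a * a ≤ M.u' a * 1 := by gcongr; exact_mod_cast ha
      _ ≤ M.u' y := by rw [mul_one]; exact hu.strictAnti_u'.antitone h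
      _ ≤ _ := le_self_add
  · calc M.u' a * a ≤ M.u' 1 * a := by gcongr; exact hu.strictAnti_u'.antitone ha
      _ ≤ _ := le_add_self

lemma monotone_u (hu : M.Utility) : Monotone M.u := by
  intro x y hxy
  rcases eq_or_ne x 0 with rfl | hx
  · exact hu.zero_le y
  have hx' : 0 < x := pos_iff_ne_zero.2 hx
  have hy' : 0 < y := hx'.trans_le hxy
  rw [hu.u_eq_uReal hx', hu.u_eq_uReal hy', EReal.coe_le_coe_iff]
  have hm : StrictMonoOn M.uReal (Set.Ioi 0) := strictMonoOn_of_deriv_pos (convex_Ioi 0)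
    (fun x hx => (hu.differentiable x hx).continuousAt.continuousWithinAt)
    (fun x hx => hu.deriv_pos x (by simpa using hx))
  exact hm.monotoneOn (NNReal.coe_pos.2 hx') (NNReal.coe_pos.2 hy') (NNReal.coe_le_coe.2 hxy)

end Utility

end Model
end IncomeFluctuation

namespace IncomeFluctuation

/-! ### Sequences of extended nonnegative numbers -/

lemma exists_nnreal_eq_one_add_mul {l : ℝ≥0} (hl : l < 1) : ∃ v : ℝ≥0, v = 1 + l * v := by
  refine ⟨(1 - l)⁻¹, ?_⟩
  have h : 0 < 1 - l := tsub_pos_of_lt hl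
  have h1 : (1 - l) * (1 - l)⁻¹ = 1 := mul_inv_cancel₀ h.ne'
  calc (1 - l)⁻¹ = ((1 - l) + l) * (1 - l)⁻¹ := by rw [tsub_add_cancel_of_le hl.le, one_mul]
    _ = _ := by rw [add_mul, h1]

/-- The partial sums never exceed X = (m₀ + ∑ y)/(1 - l), the solution of X = m₀ + lX + ∑ y. -/
lemma tsum_lt_top_of_succ_le {m y : ℕ → ℝ≥0∞} {l : ℝ≥0} (hl : l < 1) (h0 : m 0 < ⊤)
    (hy : ∑' t, y t < ⊤) (h : ∀ t, m (t + 1) ≤ l * m t + y t) : ∑' t, m t < ⊤ := by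
  obtain ⟨v, hv⟩ := exists_nnreal_eq_one_add_mul hl
  have hv' : (v : ℝ≥0∞) = 1 + l * v := by exact_mod_cast congrArg ((↑) : ℝ≥0 → ℝ≥0∞) hv
  set X := (m 0 + ∑' t, y t) * v
  have hX : X = m 0 + (l * X + ∑' t, y t) := by
    calc X = (m 0 + ∑' t, y t) * (1 + l * v) := by rw [← hv']
      _ = _ := by ring
  have hS : ∀ n, ∑ t ∈ Finset.range n, m t ≤ X := by
    intro n
    induction n with
    | zero => simp
    | succ n ih =>
      rw [Finset.sum_range_succ', add_comm, hX]
      gcongr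
      calc ∑ t ∈ Finset.range n, m (t + 1) ≤ ∑ t ∈ Finset.range n, (l * m t + y t) :=
            Finset.sum_le_sum fun t _ => h t
        _ = l * ∑ t ∈ Finset.range n, m t + ∑ t ∈ Finset.range n, y t := by
            rw [Finset.sum_add_distrib, Finset.mul_sum]
        _ ≤ l * X + ∑' t, y t := by gcongr; exact ENNReal.sum_le_tsum _
  refine lt_of_le_of_lt (ENNReal.tsum_le_of_sum_range_le hS) ?_
  exact ENNReal.mul_lt_top (ENNReal.add_lt_top.2 ⟨h0, hy⟩) ENNReal.coe_lt_top

lemma exists_bound_of_succ_le {m : ℕ → ℝ≥0∞} {W : ℝ≥0∞} {l : ℝ≥0} (hl : l < 1) (h0 : m 0 < ⊤)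
    (hW : W < ⊤) (h : ∀ t, m (t + 1) ≤ l * m t + W) : ∃ X < (⊤ : ℝ≥0∞), ∀ t, m t ≤ X := by
  obtain ⟨v, hv⟩ := exists_nnreal_eq_one_add_mul hl
  have hv' : (v : ℝ≥0∞) = 1 + l * v := by exact_mod_cast congrArg ((↑) : ℝ≥0 → ℝ≥0∞) hv
  set X := (m 0 + W) * v
  have hX : X = m 0 + (l * X + W) := by
    calc X = (m 0 + W) * (1 + l * v) := by rw [← hv']
      _ = _ := by ring
  refine ⟨X, ENNReal.mul_lt_top (ENNReal.add_lt_top.2 ⟨h0, hW⟩) ENNReal.coe_lt_top, fun t => ?_⟩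
  induction t with
  | zero => rw [hX]; exact le_self_add
  | succ t ih =>
    rw [hX]
    refine (h t).trans (le_trans ?_ le_add_self)
    gcongr

/-- Sum to a finite horizon, cancel the finite sum of the C t, and let the horizon grow so that the
remainder A vanishes. The gap δ comes from period zero alone. -/
lemma tsum_add_le_of_telescope {pd nc C pc nd D A : ℕ → ℝ≥0∞} {δ : ℝ≥0∞}
    (h0 : pd 0 + nc 0 + C 0 + δ ≤ pc 0 + nd 0 + D 0)
    (h : ∀ t, pd t + nc t + C t ≤ pc t + nd t + D t)
    (hD : ∀ T, ∑ t ∈ Finset.range T, D t ≤ ∑ t ∈ Finset.range T, C t + A T)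
    (hC : ∀ t, C t ≠ ⊤) (hA : Tendsto A atTop (𝓝 0)) :
    ∑' t, pd t + ∑' t, nc t + δ ≤ ∑' t, pc t + ∑' t, nd t := by
  have hsum : ∀ T : ℕ, ∑ t ∈ Finset.range (T + 1), (pd t + nc t + C t) + δ ≤
      ∑ t ∈ Finset.range (T + 1), (pc t + nd t + D t) := by
    intro T
    rw [Finset.sum_range_succ', Finset.sum_range_succ', add_assoc]
    exact add_le_add (Finset.sum_le_sum fun t _ => h _) h0
  have hT : ∀ T : ℕ, ∑ t ∈ Finset.range (T + 1), pd t + ∑ t ∈ Finset.range (T + 1), nc t + δ ≤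
      ∑' t, pc t + ∑' t, nd t + A (T + 1) := by
    intro T
    have h1 := hsum T
    simp only [Finset.sum_add_distrib] at h1
    have hfin : ∑ t ∈ Finset.range (T + 1), C t ≠ ⊤ := ENNReal.sum_ne_top.2 fun t _ => hC t
    refine (ENNReal.add_le_add_iff_right hfin).1 ?_
    calc _ = ∑ t ∈ Finset.range (T + 1), pd t + ∑ t ∈ Finset.range (T + 1), nc t +
          ∑ t ∈ Finset.range (T + 1), C t + δ := by ring
      _ ≤ _ := h1
      _ ≤ ∑' t, pc t + ∑' t, nd t + (∑ t ∈ Finset.range (T + 1), C t + A (T + 1)) := by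
          gcongr
          · exact ENNReal.sum_le_tsum _
          · exact ENNReal.sum_le_tsum _
          · exact hD _
      _ = _ := by ring
  have hl : Tendsto (fun T : ℕ => ∑ t ∈ Finset.range (T + 1), pd t +
      ∑ t ∈ Finset.range (T + 1), nc t + δ) atTop (𝓝 (∑' t, pd t + ∑' t, nc t + δ)) := by
    have e1 := (ENNReal.tendsto_nat_tsum pd).comp (tendsto_add_atTop_nat 1)
    have e2 := (ENNReal.tendsto_nat_tsum nc).comp (tendsto_add_atTop_nat 1)
    exact (e1.add e2).add tendsto_const_nhds
  have hr : Tendsto (fun T : ℕ => ∑' t, pc t + ∑' t, nd t + A (T + 1)) atTop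
      (𝓝 (∑' t, pc t + ∑' t, nd t)) := by
    have := (tendsto_const_nhds (x := ∑' t, pc t + ∑' t, nd t)).add
      (hA.comp (tendsto_add_atTop_nat 1))
    simpa using this
  exact le_of_tendsto_of_tendsto' hl hr hT

namespace Model

variable {Z E H : Type*} [TopologicalSpace Z] [MeasurableSpace Z] [MeasurableSpace E]
  [MeasurableSpace H] {M : Model Z E H}

/-! ### Sufficiency of the Euler equation -/

/-- Weighted discounted wealth β^t 𝔼 a_t κ(z_t) contracts by the factor l up to discounted income,
even if nothing is ever consumed (ρ = 1); and κ ≥ 1. -/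
lemma tsum_wealth_lt_top (hR : M.ReturnGrowth) (hY : M.DiscountedIncome) (hbd : M.BoundedMoments)
    (d : Policy Z) (a : ℝ≥0) (z : Z) :
    ∑' t, (M.β : ℝ≥0∞) ^ t * M.Epath z (fun ω => (M.state d a ω t).1) < ⊤ := by
  obtain ⟨n, hn, hlt⟩ := hR
  obtain ⟨κ, l, B, hκ, hl, hB, h1κ, hκB, hκl⟩ := M.exists_weight hbd hn hlt
  have hle : ∑' t, (M.β : ℝ≥0∞) ^ t * M.Epath z (fun ω => (M.state d a ω t).1) ≤
      ∑' t, (M.β : ℝ≥0∞) ^ t *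
        M.Epath z (fun ω => (M.state d a ω t).1 * κ (M.state d a ω t).2) := by
    refine ENNReal.tsum_le_tsum fun t => ?_
    gcongr
    refine lintegral_mono fun ω => ?_
    exact le_mul_of_one_le_right _root_.zero_le (h1κ _)
  refine hle.trans_lt (tsum_lt_top_of_succ_le hl
    (y := fun t => B * ((M.β : ℝ≥0∞) ^ (t + 1) * M.expInc (t + 1) z)) ?_ ?_ fun t => ?_)
  · rw [M.Epath_state_zero d a z (f := fun s => s.1 * κ s.2) (by fun_prop)]
    simpa using ENNReal.mul_lt_top ENNReal.coe_lt_top ((hκB z).trans_lt hB)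
  · rw [ENNReal.tsum_mul_left]
    exact ENNReal.mul_lt_top hB (hY z)
  · have h := M.Epath_wealth_succ_le d (ρ := 1) (fun s => by simp) hκ hκB a z t
    have hst := M.measurable_state d a t
    calc _ ≤ (M.β : ℝ≥0∞) ^ (t + 1) * (M.Epath z (fun ω => (M.state d a ω t).1 *
            ((1 : ℝ≥0) * M.retOp κ (M.state d a ω t).2)) + B * M.expInc (t + 1) z) := by gcongr
      _ = (M.β : ℝ≥0∞) ^ t * (M.β * M.Epath z (fun ω => (M.state d a ω t).1 *
            M.retOp κ (M.state d a ω t).2)) +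
            B * ((M.β : ℝ≥0∞) ^ (t + 1) * M.expInc (t + 1) z) := by
          simp only [ENNReal.coe_one, one_mul]
          ring
      _ ≤ (M.β : ℝ≥0∞) ^ t * (l * M.Epath z (fun ω => (M.state d a ω t).1 *
            κ (M.state d a ω t).2)) +
            B * ((M.β : ℝ≥0∞) ^ (t + 1) * M.expInc (t + 1) z) := by
          refine add_le_add (mul_le_mul_right ?_ _) le_rfl
          unfold Epath
          have hm := (M.measurable_retOp hκ)
          rw [← lintegral_const_mul _ (by fun_prop), ← lintegral_const_mul _ (by fun_prop)]
          refine lintegral_mono fun ω => ?_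
          calc _ = ((M.state d a ω t).1 : ℝ≥0∞) * (M.β * M.retOp κ (M.state d a ω t).2) := by ring
            _ ≤ ((M.state d a ω t).1 : ℝ≥0∞) * (l * κ (M.state d a ω t).2) := by
                exact mul_le_mul_right (hκl _) _
            _ = _ := by ring
      _ = _ := by ring

lemma Epath_u'_inc_le (z : Z) (t : ℕ) (hu' : Measurable M.u') :
    M.Epath z (fun ω => M.u' (M.inc (ω (t + 1)))) ≤ ⨆ z, M.E1 z (fun w => M.u' (M.inc w)) := by
  have h := M.Epath_succ z t (F := fun _ => ()) measurable_const (fun _ => rfl)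
    (g := fun _ w => M.u' (M.inc w)) ((hu'.comp M.measurable_inc).comp measurable_snd)
  rw [h]
  calc _ ≤ M.Epath z (fun _ => ⨆ z, M.E1 z (fun w => M.u' (M.inc w))) :=
        lintegral_mono fun ω => le_iSup (fun z => M.E1 z (fun w => M.u' (M.inc w))) _
    _ = _ := by simp [Epath]

/-! ### Euler policies, telescoping of marginal wealth, and transversality -/

/-- A policy that solves the Euler equation, at bounded distance from `u'`. -/
structure IsEuler (M : Model Z E H) (c : Policy Z) : Prop where
  le : ∀ s, M.β * M.E1 s.2 (fun w => M.ret w * M.u' (c.toFun (M.step c s w))) ≤ M.u' (c.toFun s)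
  eq : ∀ s, c.toFun s < s.1 →
    M.β * M.E1 s.2 (fun w => M.ret w * M.u' (c.toFun (M.step c s w))) = M.u' (c.toFun s)
  bounded : ∃ K < (⊤ : ℝ≥0∞), ∀ s, M.u' (c.toFun s) ≤ M.u' s.1 + K

/-- `β ^ t 𝔼 u'(c_t) a'_t` where `a'_t` is wealth under `d`. -/
def margWealth (M : Model Z E H) (c d : Policy Z) (a : ℝ≥0) (z : Z) (t : ℕ) : ℝ≥0∞ :=
  (M.β : ℝ≥0∞) ^ t *
    M.Epath z fun ω => M.u' (c.toFun (M.state c a ω t)) * (M.state d a ω t).1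

/-- `β ^ t 𝔼 u'(c_t) d_t`. -/
def margCons (M : Model Z E H) (c d : Policy Z) (a : ℝ≥0) (z : Z) (t : ℕ) : ℝ≥0∞ :=
  (M.β : ℝ≥0∞) ^ t *
    M.Epath z fun ω => M.u' (c.toFun (M.state c a ω t)) * d.toFun (M.state d a ω t)

/-- `β ^ t 𝔼 u'(c_t) (a'_t - d_t)`. -/
def margSav (M : Model Z E H) (c d : Policy Z) (a : ℝ≥0) (z : Z) (t : ℕ) : ℝ≥0∞ :=
  (M.β : ℝ≥0∞) ^ t *
    M.Epath z fun ω => M.u' (c.toFun (M.state c a ω t)) *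
      ((M.state d a ω t).1 - d.toFun (M.state d a ω t) : ℝ≥0)

/-- `β ^ (t + 1) 𝔼 u'(c_{t+1}) Y_{t+1}`. -/
def margInc (M : Model Z E H) (c : Policy Z) (a : ℝ≥0) (z : Z) (t : ℕ) : ℝ≥0∞ :=
  (M.β : ℝ≥0∞) ^ (t + 1) *
    M.Epath z fun ω => M.u' (c.toFun (M.state c a ω (t + 1))) * M.inc (ω (t + 1))

variable {c d : Policy Z}

lemma measurable_u'_state (hu' : Measurable M.u') (c : Policy Z) (a : ℝ≥0) (t : ℕ) :
    Measurable fun ω : ℕ → Z × E × H => M.u' (c.toFun (M.state c a ω t)) :=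
  hu'.comp (c.measurable'.comp (M.measurable_state c a t))

lemma margCons_add_margSav (hu' : Measurable M.u') (a : ℝ≥0) (z : Z) (t : ℕ) :
    M.margCons c d a z t + M.margSav c d a z t = M.margWealth c d a z t := by
  have h1 := measurable_u'_state hu' c a t
  have h2 := d.measurable'.comp (M.measurable_state d a t)
  have h3 : Measurable fun ω : ℕ → Z × E × H =>
      M.u' (c.toFun (M.state c a ω t)) * (d.toFun (M.state d a ω t) : ℝ≥0∞) :=
    h1.mul h2.coe_nnreal_ennreal
  unfold margCons margSav margWealth Epath
  rw [← mul_add, ← lintegral_add_left h3]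
  congr 1
  refine lintegral_congr fun ω => ?_
  rw [← mul_add, ← ENNReal.coe_add, add_tsub_cancel_of_le (d.le' _)]

/-- Substitute a'_{t+1} = R(a'_t - d_t) + Y and integrate out the shock at t + 1. The factor
multiplying savings is the left side of the Euler equation for `c`, and the income term does not
involve `d`. -/
lemma margWealth_succ (hu' : Measurable M.u') (a : ℝ≥0) (z : Z) (t : ℕ) :
    M.margWealth c d a z (t + 1) =
      (M.β : ℝ≥0∞) ^ t * M.Epath z (fun ω =>
        (M.β * M.E1 (M.state c a ω t).2 (fun w =>
          M.ret w * M.u' (c.toFun (M.step c (M.state c a ω t) w)))) *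
        ((M.state d a ω t).1 - d.toFun (M.state d a ω t) : ℝ≥0)) + M.margInc c a z t := by
  have hret := M.measurable_ret.coe_nnreal_ennreal
  have hinc := M.measurable_inc.coe_nnreal_ennreal
  have hsc := M.measurable_state c a t
  have hsd := M.measurable_state d a t
  have hm1 := measurable_u'_state hu' c a (t + 1)
  have hup : Measurable fun p : (ℝ≥0 × Z) × (Z × E × H) => M.u' (c.toFun (M.step c p.1 p.2)) :=
    hu'.comp (c.measurable'.comp (M.measurable_step c))
  let k : ℝ≥0 × Z → ℝ≥0 := fun s => s.1 - d.toFun s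
  have hk : Measurable k := measurable_fst.sub d.measurable'
  have hsplit : M.Epath z (fun ω => M.u' (c.toFun (M.state c a ω (t + 1))) *
        (M.state d a ω (t + 1)).1) =
      M.Epath z (fun ω => k (M.state d a ω t) *
        (M.ret (ω (t + 1)) * M.u' (c.toFun (M.state c a ω (t + 1))))) +
      M.Epath z (fun ω => M.u' (c.toFun (M.state c a ω (t + 1))) * M.inc (ω (t + 1))) := by
    have h3 : Measurable fun ω : ℕ → Z × E × H =>
        M.u' (c.toFun (M.state c a ω (t + 1))) * (M.inc (ω (t + 1)) : ℝ≥0∞) :=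
      hm1.mul (hinc.comp (measurable_pi_apply _))
    unfold Epath
    rw [← lintegral_add_right _ h3]
    refine lintegral_congr fun ω => ?_
    have : (M.state d a ω (t + 1)).1 =
      M.ret (ω (t + 1)) * k (M.state d a ω t) + M.inc (ω (t + 1)) := rfl
    rw [this]
    push_cast
    ring
  have hg : Measurable (Function.uncurry fun (x : (ℝ≥0 × Z) × (ℝ≥0 × Z)) (w : Z × E × H) =>
      (k x.2 : ℝ≥0∞) * (M.ret w * M.u' (c.toFun (M.step c x.1 w)))) := by
    refine ((hk.comp (measurable_snd.comp measurable_fst)).coe_nnreal_ennreal).mul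
      ((hret.comp measurable_snd).mul ?_)
    exact hup.comp ((measurable_fst.comp measurable_fst).prodMk measurable_snd)
  have hE := M.Epath_succ z t (F := fun ω => (M.state c a ω t, M.state d a ω t))
    (hsc.prodMk hsd) (fun ω => by
      simp only [M.state_min_eq c a ω t t le_rfl, M.state_min_eq d a ω t t le_rfl]) hg
  unfold margWealth margInc
  rw [hsplit, mul_add]
  congr 1
  have hE' : M.Epath z (fun ω => k (M.state d a ω t) *
        (M.ret (ω (t + 1)) * M.u' (c.toFun (M.state c a ω (t + 1))))) = _ := hE
  rw [hE', pow_succ, mul_assoc]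
  congr 1
  have hG : Measurable fun ω : ℕ → Z × E × H => M.E1 (M.state c a ω t).2 fun w =>
      (M.ret w : ℝ≥0∞) * M.u' (c.toFun (M.step c (M.state c a ω t) w)) := by
    refine M.measurable_E1 (measurable_snd.comp hsc) (g := fun ω w =>
      (M.ret w : ℝ≥0∞) * M.u' (c.toFun (M.step c (M.state c a ω t) w))) ?_
    exact (hret.comp measurable_snd).mul
      (hup.comp ((hsc.comp measurable_fst).prodMk measurable_snd))
  have hE1m : Measurable fun ω : ℕ → Z × E × H => M.E1 (ω t).1 fun w =>
      (k (M.state d a ω t) : ℝ≥0∞) * (M.ret w * M.u' (c.toFun (M.step c (M.state c a ω t) w))) :=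
    M.measurable_E1 (by fun_prop) (g := fun ω w => (k (M.state d a ω t) : ℝ≥0∞) *
      (M.ret w * M.u' (c.toFun (M.step c (M.state c a ω t) w))))
      (hg.comp (((hsc.prodMk hsd).comp measurable_fst).prodMk measurable_snd))
  unfold Epath
  rw [← lintegral_const_mul _ hE1m]
  refine lintegral_congr fun ω => ?_
  have h1 : M.E1 (ω t).1 (fun w => (k (M.state d a ω t) : ℝ≥0∞) *
      (M.ret w * M.u' (c.toFun (M.step c (M.state c a ω t) w)))) =
      k (M.state d a ω t) * M.E1 (M.state c a ω t).2 (fun w =>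
        M.ret w * M.u' (c.toFun (M.step c (M.state c a ω t) w))) := by
    rw [state_snd]
    exact lintegral_const_mul _ (hret.mul (hup.comp measurable_prodMk_left))
  rw [h1]
  change _ = _ * (k (M.state d a ω t) : ℝ≥0∞)
  ring

lemma margWealth_succ_le (hc : M.IsEuler c) (hu' : Measurable M.u') (a : ℝ≥0) (z : Z) (t : ℕ) :
    M.margWealth c d a z (t + 1) ≤ M.margSav c d a z t + M.margInc c a z t := by
  rw [margWealth_succ hu']
  unfold margSav Epath
  gcongr with ω
  simp only
  gcongr
  exact hc.le _

/-- Complementary slackness: wherever the Euler inequality may be strict, `c` saves nothing. -/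
lemma margWealth_succ_eq (hc : M.IsEuler c) (hu' : Measurable M.u') (a : ℝ≥0) (z : Z) (t : ℕ) :
    M.margWealth c c a z (t + 1) = M.margSav c c a z t + M.margInc c a z t := by
  rw [margWealth_succ hu']
  unfold margSav Epath
  congr 2
  refine lintegral_congr fun ω => ?_
  set s := M.state c a ω t
  rcases (c.le' s).lt_or_eq with h | h
  · rw [hc.eq s h]
  · simp [h]

/-- Both sides start from the same wealth and receive the same income term, while the Euler equation
is an inequality for `d` and an equality for `c`. The additive form avoids subtracting possibly
infinite quantities. -/
lemma sum_margCons_le (hc : M.IsEuler c) (hu' : Measurable M.u') (a : ℝ≥0) (z : Z) (T : ℕ) :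
    ∑ t ∈ Finset.range T, M.margCons c d a z t + M.margWealth c d a z T ≤
      ∑ t ∈ Finset.range T, M.margCons c c a z t + M.margWealth c c a z T := by
  induction T with
  | zero => simp [margWealth, state]
  | succ T ih =>
    rw [Finset.sum_range_succ, Finset.sum_range_succ, margWealth_succ_eq hc hu']
    calc _ ≤ ∑ t ∈ Finset.range T, M.margCons c d a z t + M.margCons c d a z T +
          (M.margSav c d a z T + M.margInc c a z T) := by
          gcongr
          exact margWealth_succ_le hc hu' a z T
      _ = ∑ t ∈ Finset.range T, M.margCons c d a z t + M.margWealth c d a z T +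
          M.margInc c a z T := by rw [← margCons_add_margSav hu' a z T]; ring
      _ ≤ ∑ t ∈ Finset.range T, M.margCons c c a z t + M.margWealth c c a z T +
          M.margInc c a z T := by gcongr
      _ = _ := by rw [← margCons_add_margSav hu' a z T]; ring

/-- Since a_{t+1} ≥ Y_{t+1}, u'(c)a is at most u'(Y) plus a multiple of a. Both discounted
expectations tend to zero, which is the transversality condition. -/
lemma margWealth_succ_bound (hu : M.Utility) {K : ℝ≥0∞}
    (hK : ∀ s, M.u' (c.toFun s) ≤ M.u' s.1 + K) (a : ℝ≥0) (z : Z) (t : ℕ) :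
    M.margWealth c c a z (t + 1) ≤
      (M.β : ℝ≥0∞) ^ (t + 1) * (⨆ z, M.E1 z (fun w => M.u' (M.inc w))) +
        (M.u' 1 + K) * ((M.β : ℝ≥0∞) ^ (t + 1) *
          M.Epath z (fun ω => (M.state c a ω (t + 1)).1)) := by
  have hst : Measurable fun ω : ℕ → Z × E × H => ((M.state c a ω (t + 1)).1 : ℝ≥0∞) :=
    (measurable_fst.comp (M.measurable_state c a (t + 1))).coe_nnreal_ennreal
  have h : M.Epath z (fun ω => M.u' (c.toFun (M.state c a ω (t + 1))) *
      (M.state c a ω (t + 1)).1) ≤ M.Epath z (fun ω => M.u' (M.inc (ω (t + 1)))) +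
        (M.u' 1 + K) * M.Epath z (fun ω => (M.state c a ω (t + 1)).1) := by
    unfold Epath
    rw [← lintegral_const_mul _ hst, ← lintegral_add_right _ (hst.const_mul _)]
    refine lintegral_mono fun ω => ?_
    set s := M.state c a ω (t + 1)
    have hs : M.inc (ω (t + 1)) ≤ s.1 := le_add_self
    calc M.u' (c.toFun s) * s.1 ≤ (M.u' s.1 + K) * s.1 := by gcongr; exact hK s
      _ = M.u' s.1 * s.1 + K * s.1 := by ring
      _ ≤ M.u' (M.inc (ω (t + 1))) + M.u' 1 * s.1 + K * s.1 := by
          gcongr; exact hu.u'_mul_le hs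
      _ = _ := by ring
  unfold margWealth
  calc _ ≤ (M.β : ℝ≥0∞) ^ (t + 1) * ((⨆ z, M.E1 z (fun w => M.u' (M.inc w))) +
        (M.u' 1 + K) * M.Epath z (fun ω => (M.state c a ω (t + 1)).1)) := by
        gcongr
        exact h.trans (by gcongr; exact Epath_u'_inc_le z t hu.continuous_u'.measurable)
    _ = _ := by ring

lemma tendsto_margWealth (hu : M.Utility) (hR : M.ReturnGrowth) (hY : M.DiscountedIncome)
    (hbd : M.BoundedMoments) (hc : M.IsEuler c) (a : ℝ≥0) (z : Z) :
    Tendsto (M.margWealth c c a z) atTop (𝓝 0) := by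
  obtain ⟨K, hKt, hK⟩ := hc.bounded
  rw [← tendsto_add_atTop_iff_nat 1]
  have hβ : Tendsto (fun t : ℕ => (M.β : ℝ≥0∞) ^ (t + 1)) atTop (𝓝 0) :=
    (tendsto_add_atTop_iff_nat 1).2
      (ENNReal.tendsto_pow_atTop_nhds_zero_of_lt_one (by exact_mod_cast M.β_lt_one))
  have hw : Tendsto (fun t : ℕ => (M.β : ℝ≥0∞) ^ (t + 1) *
      M.Epath z (fun ω => (M.state c a ω (t + 1)).1)) atTop (𝓝 0) :=
    (tendsto_add_atTop_iff_nat 1).2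
      (ENNReal.tendsto_atTop_zero_of_tsum_ne_top (tsum_wealth_lt_top hR hY hbd c a z).ne)
  have h1 := ENNReal.Tendsto.mul_const hβ (Or.inr hbd.marg.ne)
  have h2 := ENNReal.Tendsto.const_mul (a := M.u' 1 + K) hw
    (Or.inr (ENNReal.add_ne_top.2 ⟨u'_ne_top one_pos, hKt.ne⟩))
  have h3 := h1.add h2
  rw [zero_mul, mul_zero, add_zero] at h3
  exact tendsto_of_tendsto_of_tendsto_of_le_of_le tendsto_const_nhds h3
    (fun _ => _root_.zero_le) (fun t => margWealth_succ_bound hu hK a z t)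

lemma margWealth_ne_top (hu : M.Utility) (hR : M.ReturnGrowth) (hY : M.DiscountedIncome)
    (hbd : M.BoundedMoments) (hc : M.IsEuler c) {a : ℝ≥0} (ha : 0 < a) (z : Z) (t : ℕ) :
    M.margWealth c c a z t ≠ ⊤ := by
  obtain ⟨K, hKt, hK⟩ := hc.bounded
  cases t with
  | zero =>
    have hm : Measurable fun s : ℝ≥0 × Z => M.u' (c.toFun s) * (s.1 : ℝ≥0∞) :=
      (hu.continuous_u'.measurable.comp c.measurable').mul (by fun_prop)
    rw [margWealth, M.Epath_state_zero c a z hm, pow_zero, one_mul]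
    refine ENNReal.mul_ne_top (ne_top_of_le_ne_top ?_ (hK (a, z))) ENNReal.coe_ne_top
    exact ENNReal.add_ne_top.2 ⟨u'_ne_top ha, hKt.ne⟩
  | succ t =>
    refine ne_top_of_le_ne_top ?_ (margWealth_succ_bound hu hK a z t)
    have h1 := ENNReal.ne_top_of_tsum_ne_top (tsum_wealth_lt_top hR hY hbd c a z).ne (t + 1)
    exact ENNReal.add_ne_top.2 ⟨ENNReal.mul_ne_top (by finiteness) hbd.marg.ne,
      ENNReal.mul_ne_top (ENNReal.add_ne_top.2 ⟨u'_ne_top one_pos, hKt.ne⟩) h1⟩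

/-! ### Finiteness of lifetime values and optimality -/

/-- Expected discounted utility in period `t`, positive part. -/
def posUtil (M : Model Z E H) (c : Policy Z) (a : ℝ≥0) (z : Z) (t : ℕ) : ℝ≥0∞ :=
  (M.β : ℝ≥0∞) ^ t * M.Epath z fun ω => (M.u (c.toFun (M.state c a ω t))).toENNReal

/-- Expected discounted utility in period `t`, negative part. -/
def negUtil (M : Model Z E H) (c : Policy Z) (a : ℝ≥0) (z : Z) (t : ℕ) : ℝ≥0∞ :=
  (M.β : ℝ≥0∞) ^ t * M.Epath z fun ω => (-M.u (c.toFun (M.state c a ω t))).toENNReal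

lemma measurable_posUtil (hu : M.Utility) (c : Policy Z) :
    Measurable fun s => (M.u (c.toFun s)).toENNReal :=
  (hu.monotone_u.measurable.comp c.measurable').ereal_toENNReal

lemma measurable_negUtil (hu : M.Utility) (c : Policy Z) :
    Measurable fun s => (-M.u (c.toFun s)).toENNReal :=
  (hu.monotone_u.measurable.comp c.measurable').neg.ereal_toENNReal

lemma value_eq (hu : M.Utility) (c : Policy Z) (s : ℝ≥0 × Z) :
    M.value c s = ((∑' t, M.posUtil c s.1 s.2 t : ℝ≥0∞) : EReal) -
      ((∑' t, M.negUtil c s.1 s.2 t : ℝ≥0∞) : EReal) := by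
  have h1 : ∀ t, Measurable fun ω : ℕ → Z × E × H =>
      (M.u (c.toFun (M.state c s.1 ω t))).toENNReal := fun t =>
    (measurable_posUtil hu c).comp (M.measurable_state c s.1 t)
  have h2 : ∀ t, Measurable fun ω : ℕ → Z × E × H =>
      (-M.u (c.toFun (M.state c s.1 ω t))).toENNReal := fun t =>
    (measurable_negUtil hu c).comp (M.measurable_state c s.1 t)
  unfold value posUtil negUtil Epath
  rw [lintegral_tsum fun t => ((h1 t).const_mul _).aemeasurable,
    lintegral_tsum fun t => ((h2 t).const_mul _).aemeasurable]
  simp_rw [lintegral_const_mul _ (h1 _), lintegral_const_mul _ (h2 _)]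

lemma tsum_pow_β_lt_top (M : Model Z E H) : ∑' t : ℕ, (M.β : ℝ≥0∞) ^ t < ⊤ := by
  rw [ENNReal.tsum_geometric, ENNReal.inv_lt_top]
  exact tsub_pos_of_lt (by exact_mod_cast M.β_lt_one)

lemma tsum_posUtil_lt_top (hu : M.Utility) (hR : M.ReturnGrowth) (hY : M.DiscountedIncome)
    (hbd : M.BoundedMoments) (d : Policy Z) (a : ℝ≥0) (z : Z) :
    ∑' t, M.posUtil d a z t < ⊤ := by
  have h : ∀ t, M.posUtil d a z t ≤ (M.u 1).toENNReal * (M.β : ℝ≥0∞) ^ t +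
      M.u' 1 * ((M.β : ℝ≥0∞) ^ t * M.Epath z (fun ω => (M.state d a ω t).1)) := by
    intro t
    have hst : Measurable fun ω : ℕ → Z × E × H => ((M.state d a ω t).1 : ℝ≥0∞) :=
      (measurable_fst.comp (M.measurable_state d a t)).coe_nnreal_ennreal
    have h1 : M.Epath z (fun ω => (M.u (d.toFun (M.state d a ω t))).toENNReal) ≤
        (M.u 1).toENNReal + M.u' 1 * M.Epath z (fun ω => (M.state d a ω t).1) := by
      unfold Epath
      rw [← lintegral_const_mul _ hst]
      calc _ ≤ ∫⁻ ω, ((M.u 1).toENNReal + M.u' 1 * (M.state d a ω t).1) ∂(M.pathLaw z) := by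
            refine lintegral_mono fun ω => (hu.toENNReal_u_le _).trans ?_
            gcongr
            exact d.le' _
        _ = _ := by rw [lintegral_add_left measurable_const]; simp
    unfold posUtil
    calc _ ≤ (M.β : ℝ≥0∞) ^ t * ((M.u 1).toENNReal +
          M.u' 1 * M.Epath z (fun ω => (M.state d a ω t).1)) := by gcongr
      _ = _ := by ring
  refine (ENNReal.tsum_le_tsum h).trans_lt ?_
  rw [ENNReal.tsum_add, ENNReal.tsum_mul_left, ENNReal.tsum_mul_left]
  exact ENNReal.add_lt_top.2 ⟨ENNReal.mul_lt_top (lt_top_iff_ne_top.2 (hu.toENNReal_u_ne_top 1))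
    M.tsum_pow_β_lt_top, ENNReal.mul_lt_top (lt_top_iff_ne_top.2 (u'_ne_top one_pos))
    (tsum_wealth_lt_top hR hY hbd d a z)⟩

/-- The policy that consumes all wealth. -/
def consumeAll (Z : Type*) [MeasurableSpace Z] : Policy Z :=
  ⟨Prod.fst, measurable_fst, fun _ => le_rfl⟩

/-- From period one on this policy consumes exactly Y_t, and 𝔼 u'(Y_t) is bounded. It is the
benchmark that makes the value of an Euler policy finite. -/
lemma tsum_negUtil_consumeAll_lt_top (hu : M.Utility) (hbd : M.BoundedMoments) {a : ℝ≥0}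
    (ha : 0 < a) (z : Z) : ∑' t, M.negUtil (consumeAll Z) a z t < ⊤ := by
  set S := ⨆ z, M.E1 z (fun w => M.u' (M.inc w))
  have h0 : M.negUtil (consumeAll Z) a z 0 < ⊤ := by
    rw [negUtil, M.Epath_state_zero _ a z (measurable_negUtil hu (consumeAll Z)), pow_zero, one_mul]
    exact lt_top_iff_ne_top.2 (hu.toENNReal_neg_u_ne_top ha)
  have h : ∀ t, M.negUtil (consumeAll Z) a z (t + 1) ≤
      (M.β : ℝ≥0∞) ^ t * ((-M.u 1).toENNReal + S) := by
    intro t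
    unfold negUtil
    have hβ : (M.β : ℝ≥0∞) ^ (t + 1) ≤ (M.β : ℝ≥0∞) ^ t :=
      pow_le_pow_of_le_one _root_.zero_le (by exact_mod_cast M.β_lt_one.le) (Nat.le_succ t)
    gcongr
    calc _ ≤ M.Epath z (fun ω => (-M.u 1).toENNReal + M.u' (M.inc (ω (t + 1)))) := by
          refine lintegral_mono fun ω => ?_
          have : (consumeAll Z).toFun (M.state (consumeAll Z) a ω (t + 1)) = M.inc (ω (t + 1)) := by
            simp [consumeAll, state, step]
          rw [this]
          exact hu.toENNReal_neg_u_le _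
      _ = (-M.u 1).toENNReal + M.Epath z (fun ω => M.u' (M.inc (ω (t + 1)))) := by
          unfold Epath
          rw [lintegral_add_left measurable_const]
          simp
      _ ≤ _ := by gcongr; exact Epath_u'_inc_le z t hu.continuous_u'.measurable
  rw [tsum_eq_zero_add' ENNReal.summable]
  refine ENNReal.add_lt_top.2 ⟨h0, (ENNReal.tsum_le_tsum h).trans_lt ?_⟩
  rw [ENNReal.tsum_mul_right]
  exact ENNReal.mul_lt_top M.tsum_pow_β_lt_top (ENNReal.add_lt_top.2
    ⟨lt_top_iff_ne_top.2 (hu.toENNReal_neg_u_ne_top one_pos), hbd.marg⟩)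

/-- The comparison of `d` with `c`, stated additively so that it also serves to prove finiteness.
The initial state is deterministic, so a gap δ at time zero enters undiscounted. -/
lemma IsEuler.tsum_util_le (hc : M.IsEuler c) (hu : M.Utility) (hR : M.ReturnGrowth)
    (hY : M.DiscountedIncome) (hbd : M.BoundedMoments) (d : Policy Z) {a : ℝ≥0} (ha : 0 < a)
    (z : Z) {δ : ℝ≥0∞}
    (hδ : (M.u (d.toFun (a, z))).toENNReal + (-M.u (c.toFun (a, z))).toENNReal +
        M.u' (c.toFun (a, z)) * c.toFun (a, z) + δ ≤
      (M.u (c.toFun (a, z))).toENNReal + (-M.u (d.toFun (a, z))).toENNReal +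
        M.u' (c.toFun (a, z)) * d.toFun (a, z)) :
    ∑' t, M.posUtil d a z t + ∑' t, M.negUtil c a z t + δ ≤
      ∑' t, M.posUtil c a z t + ∑' t, M.negUtil d a z t := by
  have hu' := hu.continuous_u'.measurable
  have hmc : ∀ e : Policy Z, Measurable fun z : Z => M.u' (c.toFun (a, z)) * (e.toFun (a, z)) :=
    fun e => (hu'.comp (c.measurable'.comp measurable_prodMk_left)).mul
      (e.measurable'.comp measurable_prodMk_left).coe_nnreal_ennreal
  refine tsum_add_le_of_telescope (C := M.margCons c c a z) (D := M.margCons c d a z)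
    (A := M.margWealth c c a z) ?_ (fun t => ?_) (fun T => ?_) (fun t => ?_)
    (tendsto_margWealth hu hR hY hbd hc a z)
  · have e1 : ∀ e : Policy Z, M.posUtil e a z 0 = (M.u (e.toFun (a, z))).toENNReal := fun e => by
      rw [posUtil, M.Epath_state_zero e a z (measurable_posUtil hu e), pow_zero, one_mul]
    have e2 : ∀ e : Policy Z, M.negUtil e a z 0 = (-M.u (e.toFun (a, z))).toENNReal := fun e => by
      rw [negUtil, M.Epath_state_zero e a z (measurable_negUtil hu e), pow_zero, one_mul]
    have e3 : ∀ e : Policy Z, M.margCons c e a z 0 = M.u' (c.toFun (a, z)) * e.toFun (a, z) :=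
      fun e => by
        rw [margCons, pow_zero, one_mul]
        exact M.Epath_eval_zero z (hmc e)
    rw [e1, e1, e2, e2, e3, e3]
    exact hδ
  · have hp : ∀ e : Policy Z, Measurable fun ω : ℕ → Z × E × H =>
        (M.u (e.toFun (M.state e a ω t))).toENNReal := fun e =>
      (measurable_posUtil hu e).comp (M.measurable_state e a t)
    have hn : ∀ e : Policy Z, Measurable fun ω : ℕ → Z × E × H =>
        (-M.u (e.toFun (M.state e a ω t))).toENNReal := fun e =>
      (measurable_negUtil hu e).comp (M.measurable_state e a t)
    have hpn : ∀ e f : Policy Z, Measurable fun ω : ℕ → Z × E × H =>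
        (M.u (e.toFun (M.state e a ω t))).toENNReal +
          (-M.u (f.toFun (M.state f a ω t))).toENNReal := fun e f => (hp e).add (hn f)
    unfold posUtil negUtil margCons Epath
    rw [← mul_add, ← mul_add, ← mul_add, ← mul_add, ← lintegral_add_left (hp d),
      ← lintegral_add_left (hpn d c), ← lintegral_add_left (hp c), ← lintegral_add_left (hpn c d)]
    exact mul_le_mul_right (lintegral_mono fun ω => hu.concave _ _) _
  · exact le_self_add.trans (sum_margCons_le hc hu' a z T)
  · refine ne_top_of_le_ne_top (margWealth_ne_top hu hR hY hbd hc ha z t) ?_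
    rw [← margCons_add_margSav hu']
    exact le_self_add

/-- Comparison with `consumeAll`: the loss of `c` is at most its gain plus the loss of `consumeAll`,
and both are finite. -/
lemma IsEuler.tsum_negUtil_lt_top (hc : M.IsEuler c) (hu : M.Utility) (hR : M.ReturnGrowth)
    (hY : M.DiscountedIncome) (hbd : M.BoundedMoments) {a : ℝ≥0} (ha : 0 < a) (z : Z) :
    ∑' t, M.negUtil c a z t < ⊤ := by
  have h := hc.tsum_util_le hu hR hY hbd (consumeAll Z) ha z (δ := 0)
    (by rw [add_zero]; exact hu.concave _ _)
  rw [add_zero] at h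
  refine lt_of_le_of_lt (le_add_self.trans h) (ENNReal.add_lt_top.2 ⟨?_, ?_⟩)
  · exact tsum_posUtil_lt_top hu hR hY hbd c a z
  · exact tsum_negUtil_consumeAll_lt_top hu hbd ha z

lemma coe_sub_lt_coe_sub {p n q m δ : ℝ≥0∞} (hq : q ≠ ⊤) (hm : m ≠ ⊤) (hδ : 0 < δ)
    (hp : p ≠ ⊤) (h : p + m + δ ≤ q + n) :
    (p : EReal) - (n : EReal) < (q : EReal) - (m : EReal) := by
  lift p to ℝ≥0 using hp
  lift q to ℝ≥0 using hq
  lift m to ℝ≥0 using hm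
  rcases eq_or_ne n ⊤ with rfl | hn
  · have h1 : ((p : ℝ≥0∞) : EReal) - ((⊤ : ℝ≥0∞) : EReal) = ⊥ := by
      rw [EReal.coe_ennreal_top, sub_eq_add_neg, EReal.neg_top, EReal.add_bot]
    rw [h1]
    exact EReal.bot_lt_coe ((q : ℝ) - m)
  lift n to ℝ≥0 using hn
  have hδt : δ ≠ ⊤ := by
    rintro rfl
    rw [add_top, top_le_iff] at h
    exact absurd h (by finiteness)
  lift δ to ℝ≥0 using hδt
  have h' : p + m + δ ≤ q + n := by exact_mod_cast h
  have h'' : (p : ℝ) + m + δ ≤ q + n := by exact_mod_cast h'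
  have hδ' : (0 : ℝ) < δ := by exact_mod_cast hδ
  change (((p : ℝ) - n : ℝ) : EReal) < (((q : ℝ) - m : ℝ) : EReal)
  rw [EReal.coe_lt_coe_iff]
  linarith

lemma IsEuler.value_lt (hc : M.IsEuler c) (hu : M.Utility) (hR : M.ReturnGrowth)
    (hY : M.DiscountedIncome) (hbd : M.BoundedMoments) (d : Policy Z) {s : ℝ≥0 × Z} (hs : 0 < s.1)
    (hcs : 0 < c.toFun s) (hd : d.toFun s ≠ c.toFun s) : M.value d s < M.value c s := by
  obtain ⟨δ, hδ, h⟩ := hu.concave_strict hcs hd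
  rw [value_eq hu, value_eq hu]
  exact coe_sub_lt_coe_sub (tsum_posUtil_lt_top hu hR hY hbd c _ _).ne
    (hc.tsum_negUtil_lt_top hu hR hY hbd hs s.2).ne hδ (tsum_posUtil_lt_top hu hR hY hbd d _ _).ne
    (hc.tsum_util_le hu hR hY hbd d hs s.2 h)

lemma coe_sub_le_coe_sub {p n q m : ℝ≥0∞} (hq : q ≠ ⊤) (hm : m ≠ ⊤)
    (hp : p ≠ ⊤) (h : p + m ≤ q + n) : (p : EReal) - (n : EReal) ≤ (q : EReal) - (m : EReal) := by
  lift p to ℝ≥0 using hp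
  lift q to ℝ≥0 using hq
  lift m to ℝ≥0 using hm
  rcases eq_or_ne n ⊤ with rfl | hn
  · rw [EReal.coe_ennreal_top, sub_eq_add_neg, EReal.neg_top, EReal.add_bot]
    exact bot_le
  lift n to ℝ≥0 using hn
  have h' : p + m ≤ q + n := by exact_mod_cast h
  have h'' : (p : ℝ) + m ≤ q + n := by exact_mod_cast h'
  change (((p : ℝ) - n : ℝ) : EReal) ≤ (((q : ℝ) - m : ℝ) : EReal)
  rw [EReal.coe_le_coe_iff]
  linarith

theorem IsEuler.isOptimal (hc : M.IsEuler c) (hu : M.Utility) (hR : M.ReturnGrowth)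
    (hY : M.DiscountedIncome) (hbd : M.BoundedMoments) : M.IsOptimal c := by
  intro d s hs
  rw [value_eq hu, value_eq hu]
  refine coe_sub_le_coe_sub (tsum_posUtil_lt_top hu hR hY hbd c _ _).ne
    (hc.tsum_negUtil_lt_top hu hR hY hbd hs s.2).ne (tsum_posUtil_lt_top hu hR hY hbd d _ _).ne ?_
  simpa using hc.tsum_util_le hu hR hY hbd d hs s.2 (δ := 0)
    (by rw [add_zero]; exact hu.concave _ _)

end Model
end IncomeFluctuation

namespace IncomeFluctuation
namespace Model

variable {Z E H : Type*} [TopologicalSpace Z] [MeasurableSpace Z] [MeasurableSpace E]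
  [MeasurableSpace H]

/-! ### Continuity of conditional expectations -/

variable {M : Model Z E H}

/-- `P(z, ·)` as a probability measure. -/
def probP (M : Model Z E H) (z : Z) : ProbabilityMeasure Z := ⟨M.P z, inferInstance⟩

lemma continuous_probP [BorelSpace Z] (M : Model Z E H) : Continuous M.probP := by
  rw [continuous_iff_continuousAt]
  intro z
  rw [ContinuousAt, ProbabilityMeasure.tendsto_iff_forall_integral_tendsto]
  intro f
  exact (M.feller_P f).tendsto z

/-- The innovations carry no topology, so they are integrated last, by Fatou; for fixed innovations
the integral over ẑ is handled by weak continuity of P. -/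
lemma lowerSemicontinuous_E1 [TopologicalSpace.PseudoMetrizableSpace Z] [SecondCountableTopology Z]
    [BorelSpace Z] {X : Type*} [TopologicalSpace X]
    [TopologicalSpace.PseudoMetrizableSpace X] [SecondCountableTopology X] [MeasurableSpace X]
    [BorelSpace X] {z : X → Z} (hz : Continuous z) {F : X → Z × E × H → ℝ≥0∞}
    (hm : ∀ x, Measurable (F x))
    (hF : ∀ e : E × H, LowerSemicontinuous fun p : X × Z => F p.1 (p.2, e)) :
    LowerSemicontinuous fun x => M.E1 (z x) (F x) := by
  have h : ∀ x, M.E1 (z x) (F x) = ∫⁻ e, ∫⁻ y, F x (y, e) ∂(M.P (z x)) ∂(M.ν.prod M.μ) := by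
    intro x
    rw [E1, shock, Kernel.prod_apply, Kernel.const_apply,
      lintegral_prod_symm _ (hm x).aemeasurable]
  simp_rw [h]
  refine lowerSemicontinuous_lintegral_param (fun x => ?_) (fun e => ?_)
  · exact (hm x).lintegral_prod_left'
  · exact lowerSemicontinuous_lintegral_joint (M.continuous_probP.comp hz) (hF e)

lemma continuous_ret (hcont : M.ContinuousPrimitives) (e : E × H) :
    Continuous fun y : Z => M.ret (y, e) := hcont.R e.1

lemma continuous_inc (hcont : M.ContinuousPrimitives) (e : E × H) :
    Continuous fun y : Z => M.inc (y, e) := hcont.Y e.2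

/-- `β 𝔼_z R̂ p(R̂ k + Ŷ, ẑ)`: the discounted marginal value of saving `k`. -/
def savMarg (M : Model Z E H) (p : ℝ≥0 × Z → ℝ≥0∞) (k : ℝ≥0) (z : Z) : ℝ≥0∞ :=
  M.β * M.E1 z fun w => M.ret w * p (M.ret w * k + M.inc w, w.1)

lemma measurable_savMarg_integrand {p : ℝ≥0 × Z → ℝ≥0∞} (hp : Measurable p) (k : ℝ≥0) :
    Measurable fun w : Z × E × H => (M.ret w : ℝ≥0∞) * p (M.ret w * k + M.inc w, w.1) := by
  have h1 := M.measurable_ret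
  have h2 := M.measurable_inc
  exact h1.coe_nnreal_ennreal.mul
    (hp.comp (((h1.mul measurable_const).add h2).prodMk measurable_fst))

lemma savMarg_mono {p q : ℝ≥0 × Z → ℝ≥0∞} (h : p ≤ q) (k : ℝ≥0) (z : Z) :
    M.savMarg p k z ≤ M.savMarg q k z := by
  unfold savMarg
  exact mul_le_mul_right (lintegral_mono fun w => mul_le_mul_right (h _) _) _

lemma savMarg_anti {p : ℝ≥0 × Z → ℝ≥0∞} (hp : ∀ a b z, a ≤ b → p (b, z) ≤ p (a, z))
    {k l : ℝ≥0} (h : k ≤ l) (z : Z) : M.savMarg p l z ≤ M.savMarg p k z := by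
  unfold savMarg
  refine mul_le_mul_right (lintegral_mono fun w => mul_le_mul_right (hp _ _ _ ?_) _) _
  gcongr

lemma savMarg_le_add {p q : ℝ≥0 × Z → ℝ≥0∞} {v : Z → ℝ≥0∞} (hv : Measurable v)
    (h : ∀ s, p s ≤ q s + v s.2) (k : ℝ≥0) (z : Z) :
    M.savMarg p k z ≤ M.savMarg q k z + M.β * M.retOp v z := by
  unfold savMarg retOp
  rw [← mul_add]
  refine mul_le_mul_right ?_ _
  unfold E1
  rw [← lintegral_add_right _ (M.measurable_ret_mul hv)]
  refine lintegral_mono fun w => ?_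
  simp only
  rw [← mul_add]
  exact mul_le_mul_right (h _) _

/-- The integrand R̂ p is unbounded but dominated by R̂(u'(Ŷ) + C). It and its complement both have
lower semicontinuous expectations, and their sum is continuous by the assumptions on 𝔼_z R̂ and 𝔼_z
R̂u'(Ŷ). -/
lemma continuous_savMarg [TopologicalSpace.PseudoMetrizableSpace Z] [SecondCountableTopology Z]
    [BorelSpace Z] (hu : M.Utility) (hbd : M.BoundedMoments)
    (hcont : M.ContinuousPrimitives) {p : ℝ≥0 × Z → ℝ≥0∞} (hp : Continuous p) {C : ℝ≥0∞}
    (hC : C < ⊤) (hpC : ∀ s, p s ≤ M.u' s.1 + C) :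
    Continuous fun x : ℝ≥0 × Z => M.savMarg p x.1 x.2 := by
  have hu' := hu.continuous_u'
  have hpm := hp.measurable
  have hret := M.measurable_ret
  have hinc := M.measurable_inc
  let F : ℝ≥0 × Z → Z × E × H → ℝ≥0∞ := fun x w =>
    (M.ret w : ℝ≥0∞) * p (M.ret w * x.1 + M.inc w, w.1)
  let F' : ℝ≥0 × Z → Z × E × H → ℝ≥0∞ := fun x w =>
    (M.ret w : ℝ≥0∞) * (M.u' (M.inc w) + C - p (M.ret w * x.1 + M.inc w, w.1))
  have hle : ∀ (x : ℝ≥0 × Z) (w : Z × E × H),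
      p (M.ret w * x.1 + M.inc w, w.1) ≤ M.u' (M.inc w) + C := fun x w =>
    (hpC _).trans (add_le_add (hu.strictAnti_u'.antitone le_add_self) le_rfl)
  have hFm : ∀ x, Measurable (F x) := fun x => measurable_savMarg_integrand hpm x.1
  have hF'm : ∀ x, Measurable (F' x) := fun x => by
    have h1 : Measurable fun w : Z × E × H => p (M.ret w * x.1 + M.inc w, w.1) :=
      hpm.comp (((hret.mul measurable_const).add hinc).prodMk measurable_fst)
    exact hret.coe_nnreal_ennreal.mul
      (((hu'.measurable.comp hinc).add measurable_const).sub h1)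
  have hpc : ∀ e : E × H, Continuous fun q : (ℝ≥0 × Z) × Z =>
      p (M.ret (q.2, e) * q.1.1 + M.inc (q.2, e), q.2) := fun e => by
    have h1 := continuous_ret hcont e
    have h2 := continuous_inc hcont e
    exact hp.comp ((((h1.comp continuous_snd).mul (continuous_fst.comp continuous_fst)).add
      (h2.comp continuous_snd)).prodMk continuous_snd)
  have hF : LowerSemicontinuous fun x : ℝ≥0 × Z => M.E1 x.2 (F x) :=
    lowerSemicontinuous_E1 continuous_snd hFm fun e =>
      lowerSemicontinuous_nnreal_mul ((continuous_ret hcont e).comp continuous_snd)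
        (hpc e).lowerSemicontinuous
  have hF' : LowerSemicontinuous fun x : ℝ≥0 × Z => M.E1 x.2 (F' x) :=
    lowerSemicontinuous_E1 continuous_snd hF'm fun e =>
      lowerSemicontinuous_nnreal_mul ((continuous_ret hcont e).comp continuous_snd)
        (lowerSemicontinuous_ennreal_sub
          ((hu'.comp ((continuous_inc hcont e).comp continuous_snd)).add continuous_const)
          (hpc e))
  have hsum : ∀ x : ℝ≥0 × Z, M.E1 x.2 (F x) + M.E1 x.2 (F' x) =
      M.E1 x.2 (fun w => M.ret w * M.u' (M.inc w)) + C * M.E1 x.2 (fun w => M.ret w) := by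
    intro x
    unfold E1
    rw [← lintegral_const_mul _ hret.coe_nnreal_ennreal,
      ← lintegral_add_right _ (hret.coe_nnreal_ennreal.const_mul C),
      ← lintegral_add_left (hFm x)]
    refine lintegral_congr fun w => ?_
    simp only [F, F']
    rw [← mul_add, add_tsub_cancel_of_le (hle x w)]
    ring
  have hfin : ∀ x : ℝ≥0 × Z, M.E1 x.2 (F x) + M.E1 x.2 (F' x) ≠ ⊤ := fun x => by
    rw [hsum]
    refine ENNReal.add_ne_top.2 ⟨ne_top_of_le_ne_top hbd.ret_marg.ne
      (le_iSup (fun z => M.E1 z (fun w => M.ret w * M.u' (M.inc w))) x.2),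
      ENNReal.mul_ne_top hC.ne (ne_top_of_le_ne_top hbd.ret.ne
        (le_iSup (fun z => M.E1 z (fun w => M.ret w)) x.2))⟩
  have hc : Continuous fun x : ℝ≥0 × Z => M.E1 x.2 (F x) + M.E1 x.2 (F' x) := by
    simp_rw [hsum]
    exact (hcont.ret_marg.comp continuous_snd).add
      ((ENNReal.continuous_const_mul hC.ne).comp (hcont.ret.comp continuous_snd))
  exact (ENNReal.continuous_const_mul ENNReal.coe_ne_top).comp
    (continuous_of_lowerSemicontinuous_add hF hF' hc hfin)

/-! ### Time iteration on marginal values -/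

/-- The time iteration operator on marginal values `p = u' ∘ c`: the value at `(a, z)` is where the
decreasing function `k ↦ β 𝔼_z R̂ p(R̂ k + Ŷ, ẑ)` crosses the increasing function
`k ↦ u'(a - k)`, or `u'(a)` if the savings constraint binds. -/
def timeIter (M : Model Z E H) (p : ℝ≥0 × Z → ℝ≥0∞) (s : ℝ≥0 × Z) : ℝ≥0∞ :=
  ⨅ k ∈ Set.Iic s.1, max (M.savMarg p k s.2) (M.u' (s.1 - k))

lemma timeIter_le {p : ℝ≥0 × Z → ℝ≥0∞} {s : ℝ≥0 × Z} {k : ℝ≥0} (hk : k ≤ s.1) :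
    M.timeIter p s ≤ max (M.savMarg p k s.2) (M.u' (s.1 - k)) :=
  iInf₂_le k hk

lemma timeIter_mono {p q : ℝ≥0 × Z → ℝ≥0∞} (h : p ≤ q) : M.timeIter p ≤ M.timeIter q :=
  fun s => iInf₂_mono fun k _ => max_le_max (savMarg_mono h k s.2) le_rfl

lemma u'_le_timeIter (hu : M.Utility) (p : ℝ≥0 × Z → ℝ≥0∞) (s : ℝ≥0 × Z) :
    M.u' s.1 ≤ M.timeIter p s :=
  le_iInf₂ fun _ _ => (hu.strictAnti_u'.antitone tsub_le_self).trans (le_max_right _ _)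

lemma timeIter_anti (hu : M.Utility) (p : ℝ≥0 × Z → ℝ≥0∞) (a b : ℝ≥0) (z : Z) (h : a ≤ b) :
    M.timeIter p (b, z) ≤ M.timeIter p (a, z) := by
  refine le_iInf₂ fun k hk => (timeIter_le (s := (b, z)) (le_trans hk h)).trans ?_
  exact max_le_max le_rfl (hu.strictAnti_u'.antitone (tsub_le_tsub_right h k))

/-- A discounting property in the style of Blackwell: an error v in the marginal value passes only
through the savings term, where it becomes β 𝔼_z R̂ v(ẑ). -/
lemma timeIter_le_add {p q : ℝ≥0 × Z → ℝ≥0∞} {v : Z → ℝ≥0∞} (hv : Measurable v)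
    (h : ∀ s, p s ≤ q s + v s.2) (s : ℝ≥0 × Z) :
    M.timeIter p s ≤ M.timeIter q s + M.β * M.retOp v s.2 := by
  rw [timeIter, timeIter, ENNReal.iInf_add]
  refine le_iInf fun k => ?_
  rw [ENNReal.iInf_add]
  refine le_iInf fun hk => (timeIter_le hk).trans (max_le ?_ ?_)
  · exact (savMarg_le_add hv h k s.2).trans (add_le_add (le_max_left _ _) le_rfl)
  · exact (le_max_right _ _).trans le_self_add

lemma timeIter_le_u'_add (p : ℝ≥0 × Z → ℝ≥0∞) (s : ℝ≥0 × Z) :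
    M.timeIter p s ≤ M.u' s.1 + M.savMarg p 0 s.2 := by
  refine (timeIter_le (zero_le (a := s.1))).trans ?_
  rw [tsub_zero]
  exact max_le le_add_self le_self_add

lemma continuous_timeIter (hu : M.Utility) {p : ℝ≥0 × Z → ℝ≥0∞}
    (hG : Continuous fun x : ℝ≥0 × Z => M.savMarg p x.1 x.2) : Continuous (M.timeIter p) := by
  -- Writing k = ta with t ∈ [0, 1] makes the constraint set a fixed compact set, so the minimum is
  -- continuous in the state.
  let f : ℝ≥0 × Z → ℝ≥0 → ℝ≥0∞ := fun s t =>
    max (M.savMarg p (t * s.1) s.2) (M.u' (s.1 - t * s.1))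
  have hf : Continuous ↿f := by
    have h1 : Continuous fun x : (ℝ≥0 × Z) × ℝ≥0 => M.savMarg p (x.2 * x.1.1) x.1.2 :=
      hG.comp (f := fun x : (ℝ≥0 × Z) × ℝ≥0 => (x.2 * x.1.1, x.1.2)) (by fun_prop)
    have h2 : Continuous fun x : (ℝ≥0 × Z) × ℝ≥0 => M.u' (x.1.1 - x.2 * x.1.1) :=
      hu.continuous_u'.comp (by fun_prop)
    exact h1.max h2
  have h := (isCompact_Icc (a := (0 : ℝ≥0)) (b := 1)).continuous_sInf hf
  convert h using 1
  funext s
  rw [sInf_image]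
  refine le_antisymm (le_iInf₂ fun t ht => ?_) (le_iInf₂ fun k hk => ?_)
  · exact timeIter_le (mul_le_of_le_one_left zero_le ht.2)
  · rcases eq_or_ne s.1 0 with h0 | h0
    · refine (iInf₂_le 0 ⟨le_rfl, zero_le_one⟩).trans ?_
      have hk0 : k = 0 := le_antisymm (by rw [← h0]; exact hk) zero_le
      simp [f, hk0]
    · refine (iInf₂_le (k / s.1) ⟨zero_le, ?_⟩).trans ?_
      · simp only [f]
        rw [div_mul_cancel₀ _ h0]
      · exact div_le_one_of_le₀ (Set.mem_Iic.1 hk) zero_le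

lemma exists_timeIter_eq (hu : M.Utility) {p : ℝ≥0 × Z → ℝ≥0∞}
    (hG : Continuous fun x : ℝ≥0 × Z => M.savMarg p x.1 x.2) (s : ℝ≥0 × Z) :
    ∃ k ≤ s.1, M.timeIter p s = max (M.savMarg p k s.2) (M.u' (s.1 - k)) := by
  have hc : Continuous fun k => max (M.savMarg p k s.2) (M.u' (s.1 - k)) :=
    (hG.comp (f := fun k => (k, s.2)) (by fun_prop)).max (hu.continuous_u'.comp (by fun_prop))
  obtain ⟨k, hk, hmin⟩ := (isCompact_Icc (a := (0 : ℝ≥0)) (b := s.1)).exists_isMinOn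
    ⟨0, le_rfl, zero_le⟩ hc.continuousOn
  refine ⟨k, hk.2, le_antisymm (timeIter_le hk.2) (le_iInf₂ fun l hl => ?_)⟩
  exact hmin ⟨zero_le, hl⟩

/-- The iterates of time iteration started at `u'`, that is, from consuming all wealth. -/
def margIter (M : Model Z E H) : ℕ → ℝ≥0 × Z → ℝ≥0∞
  | 0 => fun s => M.u' s.1
  | n + 1 => M.timeIter (margIter M n)

lemma u'_le_margIter (hu : M.Utility) (n : ℕ) (s : ℝ≥0 × Z) : M.u' s.1 ≤ M.margIter n s := by
  cases n with
  | zero => exact le_rfl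
  | succ n => exact u'_le_timeIter hu _ s

lemma margIter_le_succ (hu : M.Utility) (n : ℕ) : M.margIter n ≤ M.margIter (n + 1) := by
  induction n with
  | zero => exact fun s => u'_le_timeIter hu _ s
  | succ n ih => exact timeIter_mono ih

lemma margIter_anti (hu : M.Utility) (n : ℕ) (a b : ℝ≥0) (z : Z) (h : a ≤ b) :
    M.margIter n (b, z) ≤ M.margIter n (a, z) := by
  cases n with
  | zero => exact hu.strictAnti_u'.antitone h
  | succ n => exact timeIter_anti hu _ a b z h

/-- The patience condition at wealth αa, after dropping income from next period's wealth, which only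
raises marginal utility. -/
lemma savMarg_patience (hu : M.Utility) {α : ℝ≥0}
    (hα : ∀ (a : ℝ≥0) (z : Z), 0 < a →
      M.β * M.E1 z (fun w => M.ret w * M.u' (M.ret w * (1 - α) * a)) ≤ M.u' a)
    {p : ℝ≥0 × Z → ℝ≥0∞} (hp : ∀ s, p s ≤ M.u' (α * s.1)) (s : ℝ≥0 × Z) :
    M.savMarg p ((1 - α) * s.1) s.2 ≤ M.u' (α * s.1) := by
  rcases eq_or_ne (α * s.1) 0 with h0 | h0
  · rw [h0, u'_zero]
    exact le_top
  · refine le_trans ?_ (hα (α * s.1) s.2 (pos_iff_ne_zero.2 h0))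
    unfold savMarg
    refine mul_le_mul_right (lintegral_mono fun w => mul_le_mul_right ((hp _).trans ?_) _) _
    refine hu.strictAnti_u'.antitone ?_
    calc M.ret w * (1 - α) * (α * s.1) = α * (M.ret w * ((1 - α) * s.1)) := by ring
      _ ≤ _ := by gcongr; exact le_self_add

/-- The infimum defining `timeIter` is tested at savings (1 - α)a; in terms of policies, every
iterate consumes at least αa. -/
lemma margIter_le_patience (hu : M.Utility) {α : ℝ≥0} (hα1 : α ≤ 1)
    (hα : ∀ (a : ℝ≥0) (z : Z), 0 < a →
      M.β * M.E1 z (fun w => M.ret w * M.u' (M.ret w * (1 - α) * a)) ≤ M.u' a) (n : ℕ) :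
    ∀ s, M.margIter n s ≤ M.u' (α * s.1) := by
  induction n with
  | zero => exact fun s => hu.strictAnti_u'.antitone (mul_le_of_le_one_left zero_le hα1)
  | succ n ih =>
    intro s
    refine (timeIter_le (k := (1 - α) * s.1) (mul_le_of_le_one_left zero_le tsub_le_self)).trans
      (max_le (savMarg_patience hu hα ih s) ?_)
    refine hu.strictAnti_u'.antitone (le_tsub_of_add_le_left ?_)
    rw [← add_mul, tsub_add_cancel_of_le hα1, one_mul]

/-- A fixed point of time iteration with the properties that make it the marginal value of a
candidate policy. -/
structure IsMargFixed (M : Model Z E H) (p : ℝ≥0 × Z → ℝ≥0∞) : Prop where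
  continuous : Continuous p
  fixed : M.timeIter p = p
  continuous_savMarg : Continuous fun x : ℝ≥0 × Z => M.savMarg p x.1 x.2
  u'_le : ∀ s, M.u' s.1 ≤ p s
  anti : ∀ a b z, a ≤ b → p (b, z) ≤ p (a, z)
  bounded : ∃ K < (⊤ : ℝ≥0∞), ∀ s, p s ≤ M.u' s.1 + K

theorem isMargFixed_iSup_margIter [TopologicalSpace.PseudoMetrizableSpace Z] [SecondCountableTopology Z]
    [BorelSpace Z] (hu : M.Utility) (hR : M.ReturnGrowth) (hbd : M.BoundedMoments)
    (hcont : M.ContinuousPrimitives) :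
    M.IsMargFixed fun s => ⨆ n, M.margIter n s := by
  obtain ⟨N, hN, hlt⟩ := hR
  obtain ⟨κ, l, B, hκ, hl, hB, h1κ, hκB, hκl⟩ := M.exists_weight hbd hN hlt
  obtain ⟨v, hv⟩ := exists_nnreal_eq_one_add_mul hl
  have hv' : (v : ℝ≥0∞) = 1 + l * v := by exact_mod_cast congrArg ((↑) : ℝ≥0 → ℝ≥0∞) hv
  set S := ⨆ z, M.E1 z (fun w => M.ret w * M.u' (M.inc w)) with hS
  have hSt : S < ⊤ := hbd.ret_marg
  -- C solves C = S + lC, so the bound u' + Cκ reproduces itself: S comes from u' and lC from Cκ.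
  set C := S * v with hC
  have hCt : C < ⊤ := ENNReal.mul_lt_top hSt ENNReal.coe_lt_top
  have hCS : C = S + l * C := by
    calc C = S * (1 + l * v) := by rw [← hv']
      _ = _ := by rw [hC]; ring
  have hret : ∀ r : ℝ≥0∞, ∀ z, M.β * M.retOp (fun z => r * κ z) z ≤ r * l * κ z := by
    intro r z
    rw [M.retOp_const_mul hκ]
    calc _ = r * (M.β * M.retOp κ z) := by ring
      _ ≤ r * (l * κ z) := mul_le_mul_right (hκl z) _
      _ = _ := by ring
  have hκm : ∀ r : ℝ≥0∞, Measurable fun z => r * κ z := fun r => hκ.const_mul r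
  have hbound : ∀ n s, M.margIter n s ≤ M.u' s.1 + C * κ s.2 := by
    intro n
    induction n with
    | zero => exact fun s => le_self_add
    | succ n ih =>
      intro s
      refine (timeIter_le_u'_add _ s).trans (add_le_add le_rfl ?_)
      refine (savMarg_le_add (q := fun s => M.u' s.1) (hκm C) ih 0 s.2).trans ?_
      have h1 : M.savMarg (fun s => M.u' s.1) 0 s.2 ≤ S * κ s.2 := by
        unfold savMarg
        simp only [mul_zero, zero_add]
        calc _ ≤ 1 * M.E1 s.2 (fun w => M.ret w * M.u' (M.inc w)) := by
              gcongr
              exact_mod_cast M.β_lt_one.le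
          _ ≤ S := by
              rw [one_mul]
              exact le_iSup (fun z => M.E1 z (fun w => M.ret w * M.u' (M.inc w))) s.2
          _ ≤ _ := le_mul_of_one_le_right zero_le (h1κ _)
      calc _ ≤ S * κ s.2 + C * l * κ s.2 := add_le_add h1 (hret C s.2)
        _ = (S + l * C) * κ s.2 := by ring
        _ = _ := by rw [← hCS]
  have hboundB : ∀ n s, M.margIter n s ≤ M.u' s.1 + C * B := fun n s =>
    (hbound n s).trans (add_le_add le_rfl (mul_le_mul_right (hκB _) _))
  have hCB : C * B < ⊤ := ENNReal.mul_lt_top hCt hB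
  have hsucc : ∀ n s, M.margIter (n + 1) s ≤ M.margIter n s + C * (l : ℝ≥0∞) ^ n * κ s.2 := by
    intro n
    induction n with
    | zero => intro s; simpa [margIter] using hbound 1 s
    | succ n ih =>
      intro s
      refine (timeIter_le_add (hκm _) ih s).trans (add_le_add le_rfl ?_)
      refine (hret _ s.2).trans (le_of_eq ?_)
      ring
  have hmono : ∀ s, Monotone fun n => M.margIter n s := fun s =>
    monotone_nat_of_le_succ fun n => margIter_le_succ hu n s
  -- Adding the geometric tail C lⁿ v κ, with v = 1/(1 - l), makes the increasing iterates decrease;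
  -- hence the limit lies within that tail of each iterate.
  have hanti : ∀ s, Antitone fun n : ℕ => M.margIter n s + C * (l : ℝ≥0∞) ^ n * v * κ s.2 := by
    intro s
    refine antitone_nat_of_succ_le fun n => ?_
    calc _ ≤ M.margIter n s + C * (l : ℝ≥0∞) ^ n * κ s.2 +
          C * (l : ℝ≥0∞) ^ (n + 1) * v * κ s.2 := add_le_add (hsucc n s) le_rfl
      _ = M.margIter n s + C * (l : ℝ≥0∞) ^ n * (1 + l * v) * κ s.2 := by ring
      _ = _ := by rw [← hv']
  set p : ℝ≥0 × Z → ℝ≥0∞ := fun s => ⨆ n, M.margIter n s with hp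
  have hle : ∀ n s, M.margIter n s ≤ p s := fun n s => le_iSup (fun n => M.margIter n s) n
  have hpn : ∀ n s, p s ≤ M.margIter n s + C * (l : ℝ≥0∞) ^ n * v * κ s.2 := by
    intro n s
    refine iSup_le fun m => ?_
    rcases le_total m n with h | h
    · exact (hmono s h).trans le_self_add
    · exact le_self_add.trans (hanti s h)
  have hε : Tendsto (fun n : ℕ => C * (l : ℝ≥0∞) ^ n * v * B) atTop (𝓝 0) := by
    have h1 : Tendsto (fun n : ℕ => (l : ℝ≥0∞) ^ n) atTop (𝓝 0) :=
      ENNReal.tendsto_pow_atTop_nhds_zero_of_lt_one (by exact_mod_cast hl)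
    have h2 := ENNReal.Tendsto.const_mul (a := C * v * B) h1
      (Or.inr (ENNReal.mul_ne_top (ENNReal.mul_ne_top hCt.ne ENNReal.coe_ne_top) hB.ne))
    rw [mul_zero] at h2
    refine h2.congr fun n => ?_
    ring
  have hpB : ∀ n s, p s ≤ M.margIter n s + C * (l : ℝ≥0∞) ^ n * v * B := fun n s =>
    (hpn n s).trans (add_le_add le_rfl (mul_le_mul_right (hκB _) _))
  have hcn : ∀ n, Continuous (M.margIter n) := by
    intro n
    induction n with
    | zero => exact hu.continuous_u'.comp continuous_fst
    | succ n ih =>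
      exact continuous_timeIter hu (Model.continuous_savMarg hu hbd hcont ih hCB (hboundB n))
  have hbdp : ∀ s, p s ≤ M.u' s.1 + C * B := fun s => iSup_le fun n => hboundB n s
  -- The limit is lower semicontinuous as a supremum and upper semicontinuous by uniform
  -- approximation. The error must use the constant B, since κ is only measurable.
  have hpc : Continuous p := by
    rw [continuous_iff_lower_upperSemicontinuous]
    refine ⟨lowerSemicontinuous_iSup fun n => (hcn n).lowerSemicontinuous, fun x y hy => ?_⟩
    have h1 : Tendsto (fun n : ℕ => p x + C * (l : ℝ≥0∞) ^ n * v * B) atTop (𝓝 (p x)) := by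
      simpa using (tendsto_const_nhds (x := p x)).add hε
    obtain ⟨n, hn⟩ := (h1.eventually_lt_const hy).exists
    have h2 : M.margIter n x + C * (l : ℝ≥0∞) ^ n * v * B < y :=
      lt_of_le_of_lt (add_le_add (hle n x) le_rfl) hn
    have h3 : Continuous fun x => M.margIter n x + C * (l : ℝ≥0∞) ^ n * v * B :=
      (hcn n).add continuous_const
    filter_upwards [(h3.tendsto x).eventually_lt_const h2] with x' hx'
    exact lt_of_le_of_lt (hpB n x') hx'
  refine ⟨hpc, ?_, Model.continuous_savMarg hu hbd hcont hpc hCB hbdp,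
    fun s => (u'_le_margIter hu 0 s).trans (hle 0 s),
    fun a b z h => iSup_mono fun n => margIter_anti hu n a b z h, C * B, hCB, hbdp⟩
  refine le_antisymm (fun s => ?_) (fun s => iSup_le fun n => ?_)
  · have h1 : ∀ n : ℕ, M.timeIter p s ≤ p s + C * (l : ℝ≥0∞) ^ (n + 1) * v * B := by
      intro n
      calc M.timeIter p s ≤ M.timeIter (M.margIter n) s +
            M.β * M.retOp (fun z => C * (l : ℝ≥0∞) ^ n * v * κ z) s.2 :=
            timeIter_le_add (hκm _) (hpn n) s
        _ ≤ p s + C * (l : ℝ≥0∞) ^ n * v * l * κ s.2 :=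
            add_le_add (hle (n + 1) s) (hret _ s.2)
        _ ≤ p s + C * (l : ℝ≥0∞) ^ n * v * l * B :=
            add_le_add le_rfl (mul_le_mul_right (hκB _) _)
        _ = _ := by ring
    have h2 : Tendsto (fun n : ℕ => p s + C * (l : ℝ≥0∞) ^ (n + 1) * v * B) atTop (𝓝 (p s)) := by
      simpa using (tendsto_const_nhds (x := p s)).add (hε.comp (tendsto_add_atTop_nat 1))
    exact ge_of_tendsto' h2 h1
  · exact (margIter_le_succ hu n s).trans (timeIter_mono (fun s => hle n s) s)

/-! ### The policy of a fixed point -/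

/-- u' is a strictly decreasing map onto (0, ∞], so it can be inverted at every value of p. At a = 0
one has p = ⊤, and continuity of p in `ℝ≥0∞` makes `c` continuous down to zero wealth. -/
lemma IsMargFixed.exists_policy [SecondCountableTopology Z] [BorelSpace Z]
    {p : ℝ≥0 × Z → ℝ≥0∞} (hp : M.IsMargFixed p) (hu : M.Utility) :
    ∃ c : Policy Z, Continuous c.toFun ∧ ∀ s, M.u' (c.toFun s) = p s := by
  choose f hf using fun s => hu.exists_u'_eq ((hu.u'_pos s.1).trans_le (hp.u'_le s))
  have hanti := hu.strictAnti_u'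
  have hfc : Continuous f := by
    rw [continuous_iff_lower_upperSemicontinuous]
    refine ⟨fun x y hy => ?_, fun x y hy => ?_⟩
    · have h1 : p x < M.u' y := by rw [← hf x]; exact hanti hy
      filter_upwards [(hp.continuous.tendsto x).eventually_lt_const h1] with x' hx'
      rw [← hf x'] at hx'
      exact hanti.lt_iff_gt.1 hx'
    · have h1 : M.u' y < p x := by rw [← hf x]; exact hanti hy
      filter_upwards [(hp.continuous.tendsto x).eventually_const_lt h1] with x' hx'
      rw [← hf x'] at hx'
      exact hanti.lt_iff_gt.1 hx'
  exact ⟨⟨f, hfc.measurable, fun s => hanti.le_iff_ge.1 (by rw [hf]; exact hp.u'_le s)⟩, hfc, hf⟩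

variable {c : Policy Z}

/-- The minimizing k satisfies u'(a - k) ≤ p = u'(c), so k ≤ a - c and monotonicity in savings gives
the inequality. -/
lemma IsMargFixed.isEuler {p : ℝ≥0 × Z → ℝ≥0∞} (hp : M.IsMargFixed p) (hu : M.Utility)
    (hc : ∀ s, M.u' (c.toFun s) = p s) : M.IsEuler c := by
  have hanti := hu.strictAnti_u'
  have hG : ∀ s : ℝ≥0 × Z, M.β * M.E1 s.2 (fun w => M.ret w * M.u' (c.toFun (M.step c s w))) =
      M.savMarg p (s.1 - c.toFun s) s.2 := by
    intro s
    simp only [hc]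
    rfl
  have hle : ∀ s : ℝ≥0 × Z, M.savMarg p (s.1 - c.toFun s) s.2 ≤ p s := by
    intro s
    obtain ⟨k, hk, hke⟩ := exists_timeIter_eq hu hp.continuous_savMarg s
    rw [hp.fixed] at hke
    have h1 : M.u' (s.1 - k) ≤ M.u' (c.toFun s) := by
      rw [hc, hke]
      exact le_max_right _ _
    have h2 : c.toFun s ≤ s.1 - k := hanti.le_iff_ge.1 h1
    have h3 : k ≤ s.1 - c.toFun s := by
      refine le_tsub_of_add_le_left ?_
      calc c.toFun s + k ≤ s.1 - k + k := add_le_add h2 le_rfl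
        _ = s.1 := tsub_add_cancel_of_le hk
    calc _ ≤ M.savMarg p k s.2 := savMarg_anti hp.anti h3 s.2
      _ ≤ p s := by rw [hke]; exact le_max_left _ _
  refine ⟨fun s => ?_, fun s hs => ?_, ?_⟩
  · rw [hG, hc]
    exact hle s
  · rw [hG, hc]
    refine le_antisymm (hle s) ?_
    set k₀ := s.1 - c.toFun s with hk₀
    have hk₀0 : 0 < k₀ := tsub_pos_of_lt hs
    -- Saving less than a - c leaves u'(a - k) strictly below p, so the savings term must attain p
    -- in the maximum; continuity from the left extends this to k₀.
    have h1 : ∀ k < k₀, p s ≤ M.savMarg p k s.2 := by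
      intro k hk
      have hks : k ≤ s.1 := hk.le.trans tsub_le_self
      have h2 := timeIter_le (M := M) (p := p) hks
      rw [hp.fixed] at h2
      have h3 : M.u' (s.1 - k) < p s := by
        rw [← hc]
        refine hanti ?_
        rw [hk₀, lt_tsub_iff_right] at hk
        rwa [lt_tsub_iff_right, add_comm]
      exact (le_max_iff.1 h2).resolve_right (not_le.2 h3)
    have hcont : Continuous fun k => M.savMarg p k s.2 :=
      hp.continuous_savMarg.comp (f := fun k => (k, s.2)) (by fun_prop)
    have : (𝓝[<] k₀).NeBot := nhdsLT_neBot_of_exists_lt ⟨0, hk₀0⟩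
    refine ge_of_tendsto ((hcont.tendsto k₀).mono_left (nhdsWithin_le_nhds (s := Set.Iio k₀))) ?_
    filter_upwards [self_mem_nhdsWithin] with k hk
    exact h1 k hk
  · obtain ⟨K, hK, h⟩ := hp.bounded
    exact ⟨K, hK, fun s => by rw [hc]; exact h s⟩

lemma IsMargFixed.candidate {p : ℝ≥0 × Z → ℝ≥0∞} (hp : M.IsMargFixed p) (hu : M.Utility)
    (hcc : Continuous c.toFun) (hc : ∀ s, M.u' (c.toFun s) = p s) : M.Candidate c := by
  have hanti := hu.strictAnti_u'
  obtain ⟨K, hK, hpK⟩ := hp.bounded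
  have hpos : ∀ s : ℝ≥0 × Z, 0 < s.1 → 0 < c.toFun s := by
    intro s hs
    rw [pos_iff_ne_zero]
    intro h0
    have h1 := hc s
    rw [h0, u'_zero] at h1
    have h2 := hpK s
    rw [← h1, top_le_iff] at h2
    exact ENNReal.add_ne_top.2 ⟨u'_ne_top hs, hK.ne⟩ h2
  refine ⟨hcc.continuousOn, fun a b z _ hab => ?_, hpos, K.toReal, fun s hs => ?_⟩
  · refine hanti.le_iff_ge.1 ?_
    rw [hc, hc]
    exact hp.anti a b z hab
  · have h1 := hpK s
    rw [← hc, u'_of_pos (hpos s hs), u'_of_pos hs, ← ENNReal.ofReal_toReal hK.ne,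
      ← ENNReal.ofReal_add (hu.deriv_pos _ (NNReal.coe_pos.2 hs)).le ENNReal.toReal_nonneg,
      ENNReal.ofReal_le_ofReal_iff (add_nonneg (hu.deriv_pos _ (NNReal.coe_pos.2 hs)).le
        ENNReal.toReal_nonneg)] at h1
    have h2 : deriv M.uReal s.1 ≤ deriv M.uReal (c.toFun s) :=
      hu.strictAntiOn_deriv.antitoneOn (NNReal.coe_pos.2 (hpos s hs)) (NNReal.coe_pos.2 hs)
        (NNReal.coe_le_coe.2 (c.le' s))
    rw [abs_of_nonneg (by linarith)]
    linarith

theorem exists_euler_candidate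
    [TopologicalSpace.PseudoMetrizableSpace Z] [SecondCountableTopology Z]
    [BorelSpace Z] (hu : M.Utility) (hR : M.ReturnGrowth) (hbd : M.BoundedMoments)
    (hcont : M.ContinuousPrimitives) {α : ℝ≥0} (hα1 : α ≤ 1)
    (hα : ∀ (a : ℝ≥0) (z : Z), 0 < a →
      M.β * M.E1 z (fun w => M.ret w * M.u' (M.ret w * (1 - α) * a)) ≤ M.u' a) :
    ∃ c : Policy Z, Continuous c.toFun ∧ M.Candidate c ∧ M.IsEuler c ∧
      ∀ s, α * s.1 ≤ c.toFun s := by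
  have hp := isMargFixed_iSup_margIter hu hR hbd hcont
  obtain ⟨c, hcc, hc⟩ := hp.exists_policy hu
  refine ⟨c, hcc, hp.candidate hu hcc hc, hp.isEuler hu hc, fun s => ?_⟩
  refine hu.strictAnti_u'.le_iff_ge.1 ?_
  rw [hc]
  exact iSup_le fun n => margIter_le_patience hu hα1 hα n s

/-! ### Stability -/

/-- The complement argument again, for ‖h‖ + h and ‖h‖ - h: both integrals are lower semicontinuous
and they sum to a constant. -/
lemma isFeller_stateKernel [TopologicalSpace.PseudoMetrizableSpace Z] [SecondCountableTopology Z]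
    [BorelSpace Z] (hcont : M.ContinuousPrimitives) (hcc : Continuous c.toFun) :
    IsFeller (M.stateKernel c) := by
  have hlsc : ∀ g : (ℝ≥0 × Z) → ℝ≥0∞, Continuous g →
      LowerSemicontinuous fun s => ∫⁻ y, g y ∂(M.stateKernel c s) := by
    intro g hg
    have hs : ∀ s, Measurable (M.step c s) := fun s =>
      (M.measurable_step c).comp measurable_prodMk_left
    have h : ∀ s, ∫⁻ y, g y ∂(M.stateKernel c s) = M.E1 s.2 (fun w => g (M.step c s w)) := by
      intro s
      rw [stateKernel_apply, lintegral_map hg.measurable (hs s)]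
      rfl
    simp_rw [h]
    refine lowerSemicontinuous_E1 continuous_snd (fun s => hg.measurable.comp (hs s)) fun e => ?_
    refine Continuous.lowerSemicontinuous (hg.comp ?_)
    have h1 := continuous_ret hcont e
    have h2 := continuous_inc hcont e
    have h3 : Continuous fun q : (ℝ≥0 × Z) × Z => q.1.1 - c.toFun q.1 :=
      (continuous_fst.comp continuous_fst).sub (hcc.comp continuous_fst)
    exact (((h1.comp continuous_snd).mul h3).add (h2.comp continuous_snd)).prodMk continuous_snd
  intro h
  let g : ℝ≥0 × Z → ℝ≥0∞ := fun s => ENNReal.ofReal (‖h‖ + h s)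
  let g' : ℝ≥0 × Z → ℝ≥0∞ := fun s => ENNReal.ofReal (‖h‖ - h s)
  have hg : Continuous g := ENNReal.continuous_ofReal.comp (by fun_prop)
  have hg' : Continuous g' := ENNReal.continuous_ofReal.comp (by fun_prop)
  have hb : ∀ s, 0 ≤ ‖h‖ + h s ∧ 0 ≤ ‖h‖ - h s := fun s => by
    have h1 := abs_le.1 (h.norm_coe_le_norm s)
    constructor <;> linarith [h1.1, h1.2]
  have hsum : ∀ s, ∫⁻ y, g y ∂(M.stateKernel c s) + ∫⁻ y, g' y ∂(M.stateKernel c s) =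
      ENNReal.ofReal (2 * ‖h‖) := by
    intro s
    rw [← lintegral_add_left hg.measurable]
    have : ∀ y, g y + g' y = ENNReal.ofReal (2 * ‖h‖) := fun y => by
      simp only [g, g']
      rw [← ENNReal.ofReal_add (hb y).1 (hb y).2]
      congr 1
      ring
    simp [this]
  have hcg : Continuous fun s => ∫⁻ y, g y ∂(M.stateKernel c s) := by
    refine continuous_of_lowerSemicontinuous_add (hlsc g hg) (hlsc g' hg') ?_ fun s => ?_
    · simp_rw [hsum]
      exact continuous_const
    · rw [hsum]
      exact ENNReal.ofReal_ne_top
  have heq : ∀ s, ∫ y, h y ∂(M.stateKernel c s) =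
      (∫⁻ y, g y ∂(M.stateKernel c s)).toReal - ‖h‖ := by
    intro s
    have hi : Integrable (fun y => ‖h‖ + h y) (M.stateKernel c s) :=
      (integrable_const _).add (h.integrable _)
    rw [← integral_eq_lintegral_of_nonneg_ae (Eventually.of_forall fun y => (hb y).1)
      hi.aestronglyMeasurable, integral_add (integrable_const _) (h.integrable _)]
    simp
  simp_rw [heq]
  refine Continuous.sub ?_ continuous_const
  rw [continuous_iff_continuousAt]
  intro s
  refine ContinuousAt.comp (g := ENNReal.toReal) (ENNReal.continuousAt_toReal ?_) hcg.continuousAt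
  refine ne_top_of_le_ne_top ?_ (le_self_add (b := ∫⁻ y, g' y ∂(M.stateKernel c s)))
  rw [hsum]
  exact ENNReal.ofReal_ne_top

/-- Tightness on a product reduces to the marginals. That of z_t is Pᵗ(z, ·); for wealth, savings of
at most (1 - α)a make 𝔼 a_t κ(z_t) contract up to bounded income, and Markov's inequality applies.
-/
lemma boundedInProbability_stateKernel (hbd : M.BoundedMoments) (hinc : M.BoundedIncome)
    (hP : BoundedInProbability M.P) {α : ℝ≥0} {n : ℕ} (hn : 1 ≤ n)
    (hlt : ((1 - α : ℝ≥0) : ℝ≥0∞) ^ n * (⨆ z, M.expRetProd n z) < 1)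
    (hc : ∀ s, α * s.1 ≤ c.toFun s) : BoundedInProbability (M.stateKernel c) := by
  rintro ⟨a, z⟩
  obtain ⟨κ, l, B, hκ, hl, hB, h1κ, hκB, hκl⟩ := M.exists_weight hbd hn hlt
  have hρ : ∀ s : ℝ≥0 × Z, s.1 - c.toFun s ≤ (1 - α) * s.1 := fun s => by
    rw [tsub_mul, one_mul]
    exact tsub_le_tsub_left (hc s) _
  obtain ⟨X, hX, hXle⟩ : ∃ X < (⊤ : ℝ≥0∞), ∀ t, M.Epath z (fun ω =>
      (M.state c a ω t).1 * κ (M.state c a ω t).2) ≤ X := by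
    refine exists_bound_of_succ_le (W := B * ⨆ t : ℕ, M.expInc (t + 1) z) hl ?_
      (ENNReal.mul_lt_top hB (hinc z)) fun t => ?_
    · rw [M.Epath_state_zero c a z (f := fun s => s.1 * κ s.2) (by fun_prop)]
      exact ENNReal.mul_lt_top ENNReal.coe_lt_top ((hκB z).trans_lt hB)
    · refine (M.Epath_wealth_succ_le c hρ hκ hκB a z t).trans (add_le_add ?_
        (mul_le_mul_right (le_iSup (fun t : ℕ => M.expInc (t + 1) z) t) _))
      have hst := M.measurable_state c a t
      unfold Epath
      rw [← lintegral_const_mul _ (by fun_prop)]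
      refine lintegral_mono fun ω => ?_
      calc ((M.state c a ω t).1 : ℝ≥0∞) * (((1 - α : ℝ≥0) : ℝ≥0∞) *
            M.retOp κ (M.state c a ω t).2)
          ≤ (M.state c a ω t).1 * (l * κ (M.state c a ω t).2) := mul_le_mul_right (hκl _) _
        _ = _ := by ring
  have hmean : ∀ t, ∫⁻ s, (s.1 : ℝ≥0∞) ∂((M.stateKernel c) ^ t) (a, z) ≤ X := by
    intro t
    rw [← M.Epath_state_eq c a z t (by fun_prop)]
    refine le_trans (lintegral_mono fun ω => ?_) (hXle t)
    exact le_mul_of_one_le_right zero_le (h1κ _)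
  refine IsTightMeasureSet.prodMk ?_ ?_
  · rw [isTightMeasureSet_iff_exists_isCompact_measure_compl_le]
    intro ε hε
    obtain ⟨N, hN0, hN⟩ : ∃ N : ℝ≥0, 0 < N ∧ X / N ≤ ε := by
      have h1 : Tendsto (fun N : ℕ => X / (N : ℝ≥0∞)) atTop (𝓝 0) :=
        ENNReal.Tendsto.const_div ENNReal.tendsto_nat_nhds_top (Or.inr hX.ne) |>.trans
          (by rw [ENNReal.div_top])
      obtain ⟨N, hN, hN0⟩ := ((h1.eventually_lt_const hε).and (eventually_gt_atTop 0)).exists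
      exact ⟨N, by exact_mod_cast hN0, by simpa using hN.le⟩
    refine ⟨Set.Icc 0 N, isCompact_Icc, ?_⟩
    rintro _ ⟨_, ⟨t, rfl⟩, rfl⟩
    refine le_trans ?_ ((ENNReal.div_le_div_right (hmean t) N).trans hN)
    rw [Measure.fst_apply measurableSet_Icc.compl]
    refine le_trans (measure_mono ?_) (meas_ge_le_lintegral_div (f := fun s : ℝ≥0 × Z =>
      (s.1 : ℝ≥0∞)) (by fun_prop) (by simpa using hN0.ne') ENNReal.coe_ne_top)
    intro s hs
    have : ¬ s.1 ≤ N := fun h => hs ⟨zero_le, h⟩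
    exact ENNReal.coe_le_coe.2 (not_le.1 this).le
  · refine (hP z).subset ?_
    rintro _ ⟨_, ⟨t, rfl⟩, rfl⟩
    refine ⟨t, ?_⟩
    refine Measure.ext_of_lintegral _ fun f hf => ?_
    rw [Measure.snd, lintegral_map hf measurable_snd, ← M.Epath_eval_fst_eq z t hf,
      ← M.Epath_state_eq c a z t (f := fun s => f s.2) (hf.comp measurable_snd)]
    simp_rw [state_snd]

end Model
end IncomeFluctuation
end

/-! ### Conclusion -/

theorem theoremt {m : ℕ} (Z : Set (EuclideanSpace ℝ (Fin m))) (hZ : MeasurableSet Z)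
    (hne : Z.Nonempty) {E H : Type*} [MeasurableSpace E] [MeasurableSpace H]
    (M : IncomeFluctuation.Model Z E H)
    (hu : M.Utility) (hR : M.ReturnGrowth) (hY : M.DiscountedIncome) (hbd : M.BoundedMoments)
    (hcont : M.ContinuousPrimitives) (hpat : M.Patience) (hinc : M.BoundedIncome)
    (hP : IncomeFluctuation.BoundedInProbability M.P) :
    ∃ c : IncomeFluctuation.Policy Z,
      (M.Candidate c ∧ M.IsOptimal c ∧
        ∀ d : IncomeFluctuation.Policy Z, M.Candidate d → M.IsOptimal d → d = c) ∧
      IncomeFluctuation.BoundedInProbability (M.stateKernel c) ∧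
      ∃ ψ : MeasureTheory.Measure (NNReal × Z),
        IncomeFluctuation.IsStationary (M.stateKernel c) ψ := by
  obtain ⟨α, -, hα1, hα, n, hn, hlt⟩ := hpat
  obtain ⟨c, hcc, hcand, hEu, hcα⟩ :=
    IncomeFluctuation.Model.exists_euler_candidate hu hR hbd hcont hα1.le hα
  have htight := IncomeFluctuation.Model.boundedInProbability_stateKernel hbd hinc hP hn hlt hcα
  refine ⟨c, ⟨hcand, hEu.isOptimal hu hR hY hbd, fun d _ hd => ?_⟩, htight, ?_⟩
  · refine IncomeFluctuation.Policy.ext (funext fun s => ?_)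
    rcases eq_or_ne s.1 0 with h0 | h0
    · have hz : ∀ e : IncomeFluctuation.Policy Z, e.toFun s = 0 := fun e =>
        le_antisymm (h0 ▸ e.le' s) zero_le
      rw [hz, hz]
    -- An optimal `d` would have to match the value of `c` at `s`, but any deviation from `c` there
    -- is strictly worse. The candidate property of `d` plays no role.
    · by_contra hne'
      have hs : 0 < s.1 := pos_iff_ne_zero.2 h0
      exact absurd (hd c s hs) (not_le.2 (hEu.value_lt hu hR hY hbd d hs (hcand.pos s hs) hne'))
  · obtain ⟨z, hz⟩ := hne
    -- Any initial state would do, since tightness holds from all of them; zero wealth is allowed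
    -- because `c` is continuous there.
    exact IncomeFluctuation.exists_isStationary _
      (IncomeFluctuation.Model.isFeller_stateKernel hcont hcc) (0, ⟨z, hz⟩) (htight _)
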